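/- Consider first-order logic on finite non-empty simple graphs, with equality and adjacency as the only relations, extended by the counting quantifiers $\exists^m x\,\Psi$ ("there are at least $m$ vertices $x$ with property $\Psi$"), $m\in\mathbb N$. The quantifier depth of a formula is the maximum length of a chain of nested quantifiers in it, where each quantifier $\exists$, $\forall$, $\exists^m$ contributes $1$ irrespective of $m$. A sentence defines a graph $G$ if it is true on $G$ and false on every finite non-empty graph not isomorphic to $G$. Let $D_{\#}^{3}(G)$ be the minimum quantifier depth of a sentence of this counting logic that uses at most three variable symbols (which may be re-quantified) and defines $G$, with $D_{\#}^{3}(G)=\infty$ if there is no such sentence. Then for every tree $T$ on $n\ge 2$ vertices, $$D_{\#}^{3}(T)<3\log_2 n .$$ -/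

import Mathlib

universe u

/-- Formulas of first-order logic with counting quantifiers over the vocabulary of graphs
(equality and adjacency), in which only the `k` variable symbols `x i`, `i : Fin k`, are
available; a variable may be re-quantified. -/
inductive CountingFormula (k : ℕ) : Type
  | eq (i j : Fin k) : CountingFormula k
  | adj (i j : Fin k) : CountingFormula k
  | neg (φ : CountingFormula k) : CountingFormula k
  | and (φ ψ : CountingFormula k) : CountingFormula k
  | or (φ ψ : CountingFormula k) : CountingFormula k
  | ex (i : Fin k) (φ : CountingFormula k) : CountingFormula k
  | all (i : Fin k) (φ : CountingFormula k) : CountingFormula k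
  /-- `atLeast m i φ`: there are at least `m` vertices `x i` such that `φ`. -/
  | atLeast (m : ℕ) (i : Fin k) (φ : CountingFormula k) : CountingFormula k

namespace CountingFormula

variable {k : ℕ}

/-- The quantifier depth: the maximum length of a chain of nested quantifiers, where a
counting quantifier contributes `1` whatever its threshold is. -/
def depth : CountingFormula k → ℕ
  | eq _ _ => 0
  | adj _ _ => 0
  | neg φ => φ.depth
  | and φ ψ => max φ.depth ψ.depth
  | or φ ψ => max φ.depth ψ.depth
  | ex _ φ => φ.depth + 1
  | all _ φ => φ.depth + 1
  | atLeast _ _ φ => φ.depth + 1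

/-- The set of free variables. -/
def freeVars : CountingFormula k → Finset (Fin k)
  | eq i j => {i, j}
  | adj i j => {i, j}
  | neg φ => φ.freeVars
  | and φ ψ => φ.freeVars ∪ ψ.freeVars
  | or φ ψ => φ.freeVars ∪ ψ.freeVars
  | ex i φ => φ.freeVars.erase i
  | all i φ => φ.freeVars.erase i
  | atLeast _ i φ => φ.freeVars.erase i

/-- A sentence is a formula without free variables. -/
def IsSentence (φ : CountingFormula k) : Prop := φ.freeVars = ∅

/-- Truth of a formula in the graph `G` under the assignment `s` of vertices to variables. -/
def Realize {V : Type*} (G : SimpleGraph V) : CountingFormula k → (Fin k → V) → Prop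
  | eq i j, s => s i = s j
  | adj i j, s => G.Adj (s i) (s j)
  | neg φ, s => ¬ φ.Realize G s
  | and φ ψ, s => φ.Realize G s ∧ ψ.Realize G s
  | or φ ψ, s => φ.Realize G s ∨ ψ.Realize G s
  | ex i φ, s => ∃ a : V, φ.Realize G (Function.update s i a)
  | all i φ, s => ∀ a : V, φ.Realize G (Function.update s i a)
  | atLeast m i φ, s =>
      ∃ A : Finset V, A.card = m ∧ ∀ a ∈ A, φ.Realize G (Function.update s i a)

/-- `φ` is true in `G`. For a sentence and a nonempty `V` the assignment is irrelevant. -/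
def Holds {V : Type*} (φ : CountingFormula k) (G : SimpleGraph V) : Prop :=
  ∀ s : Fin k → V, φ.Realize G s

/-- `φ` defines the graph `G` (up to isomorphism): it is a sentence that is true in `G` and
false in every finite nonempty graph that is not isomorphic to `G`. -/
def Defines {V : Type u} (φ : CountingFormula k) (G : SimpleGraph V) : Prop :=
  φ.IsSentence ∧ φ.Holds G ∧
    ∀ (W : Type u) [Finite W] [Nonempty W] (H : SimpleGraph W),
      ¬ Nonempty (G ≃g H) → ¬ φ.Holds H

end CountingFormula

/-- The logical depth of `G` in the `k`-variable counting logic: the minimum quantifier depth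
of a sentence of this logic that defines `G`, and `⊤` if there is no such sentence. -/
noncomputable def countingDepth (k : ℕ) {V : Type u} (G : SimpleGraph V) : ℕ∞ :=
  ⨅ φ : {φ : CountingFormula k // φ.Defines G}, (φ.1.depth : ℕ∞)

/-! Counting logic with three variables simulates two-dimensional Weisfeiler-Leman refinement: the
colour of a pair after `r` rounds is definable in depth `r`, the multiset of vertex colours in depth
`r + 1`. It remains to bound the rounds that identify `T` (`nonempty_iso_of_colorMultiset_eq`).

After `e` rounds colours determine distances up to `2 ^ e`. Hence a graph with the colours of `T` is
a tree, and betweenness can be read off. The tree is then recovered from the isomorphism types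
(`code`) of the branches at a centroid, all of size at most `n / 2`. The side branches along a path
from `p` to `w` (`profile`) determine the whole branch at `p` containing `w`
(`code_next_eq_of_profile_eq`). So the multiplicity of a branch type at `p` follows from the number
of vertices `w` with a suitable profile (`count_codesAvoiding_mul`), which one more round can see.

Two recursions interlock in `agree`. For branches of size at most `b`, `w` is a centroid of the
branch: the inner part of the path to `w` and each branch beyond `w` have size at most `b / 2`. For
paths whose inner vertices carry weight `m`, a median vertex leaves at most `m / 2` in each half,
and its side branches have fewer than `m` vertices. A halving thus costs two rounds, and about `2
log b + e` rounds suffice; `b = n / 2` and `e` near `log n` give the bound. -/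

open Finset

noncomputable section

open scoped Classical

/-! ### Properties expressible with bounded depth and given free variables. -/

namespace CountingFormula

/-- A property of assignments of `k` variables in finite graphs. -/
abbrev AssignmentProp (k : ℕ) : Type (u + 1) :=
  ∀ (V : Type u) [Fintype V], SimpleGraph V → (Fin k → V) → Prop

/-- `P` is expressed by a formula of depth at most `d` with free variables in `A`. -/
def Expressible {k : ℕ} (d : ℕ) (A : Finset (Fin k)) (P : AssignmentProp.{u} k) : Prop :=
  ∃ φ : CountingFormula k, φ.depth ≤ d ∧ φ.freeVars ⊆ A ∧
    ∀ (V : Type u) [Fintype V] (G : SimpleGraph V) (s : Fin k → V), φ.Realize G s ↔ P V G s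

namespace Expressible

variable {k d e : ℕ} {A B : Finset (Fin k)} {P Q : AssignmentProp.{u} k}

theorem mono (h : Expressible d A P) (hd : d ≤ e) (hA : A ⊆ B) : Expressible e B P := by
  obtain ⟨φ, h1, h2, h3⟩ := h
  exact ⟨φ, h1.trans hd, h2.trans hA, h3⟩

theorem congr (h : Expressible d A P)
    (hPQ : ∀ (V : Type u) [Fintype V] (G : SimpleGraph V) (s : Fin k → V),
      P V G s ↔ Q V G s) : Expressible d A Q := by
  obtain ⟨φ, h1, h2, h3⟩ := h
  exact ⟨φ, h1, h2, fun V _ G s => (h3 V G s).trans (hPQ V G s)⟩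

theorem not (h : Expressible d A P) : Expressible d A (fun V _ G s => ¬ P V G s) := by
  obtain ⟨φ, h1, h2, h3⟩ := h
  exact ⟨.neg φ, h1, h2, fun V _ G s => not_congr (h3 V G s)⟩

theorem and (hP : Expressible d A P) (hQ : Expressible d A Q) :
    Expressible d A (fun V _ G s => P V G s ∧ Q V G s) := by
  obtain ⟨φ, h1, h2, h3⟩ := hP
  obtain ⟨ψ, g1, g2, g3⟩ := hQ
  exact ⟨.and φ ψ, max_le h1 g1, union_subset h2 g2,
    fun V _ G s => and_congr (h3 V G s) (g3 V G s)⟩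

theorem forall_mem {ι : Type*} {P : ι → AssignmentProp.{u} k}
    (h0 : Expressible.{u} d A (fun _ _ _ _ => True)) (S : Finset ι)
    (h : ∀ a ∈ S, Expressible d A (P a)) :
    Expressible d A (fun V _ G s => ∀ a ∈ S, P a V G s) := by
  induction S using Finset.induction_on with
  | empty => exact h0.congr (by simp)
  | insert a S _ ih =>
    refine ((h a (mem_insert_self a S)).and
      (ih fun b hb => h b (mem_insert_of_mem hb))).congr ?_
    simp

theorem exists_mem {ι : Type*} {P : ι → AssignmentProp.{u} k}
    (h0 : Expressible.{u} d A (fun _ _ _ _ => True)) (S : Finset ι)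
    (h : ∀ a ∈ S, Expressible d A (P a)) :
    Expressible d A (fun V _ G s => ∃ a ∈ S, P a V G s) :=
  (forall_mem h0 S fun a ha => (h a ha).not).not.congr (by simp)

theorem all (i : Fin k) (h : Expressible d A P) :
    Expressible (d + 1) (A.erase i) (fun V _ G s => ∀ a, P V G (Function.update s i a)) := by
  obtain ⟨φ, h1, h2, h3⟩ := h
  exact ⟨.all i φ, Nat.succ_le_succ h1, erase_subset_erase i h2,
    fun V _ G s => forall_congr' fun a => h3 V G _⟩

theorem atLeast (m : ℕ) (i : Fin k) (h : Expressible d A P) :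
    Expressible (d + 1) (A.erase i)
      (fun V _ G s => m ≤ #{a | P V G (Function.update s i a)}) := by
  obtain ⟨φ, h1, h2, h3⟩ := h
  refine ⟨.atLeast m i φ, Nat.succ_le_succ h1, erase_subset_erase i h2, fun V _ G s => ?_⟩
  simp only [Realize, h3]
  constructor
  · rintro ⟨S, rfl, hS⟩
    exact card_le_card fun a ha => by simpa using hS a ha
  · intro hm
    obtain ⟨S, hS, hc⟩ := exists_subset_card_eq hm
    exact ⟨S, hc, fun a ha => by simpa using hS ha⟩

theorem exactly (m : ℕ) (i : Fin k) (h : Expressible d A P) :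
    Expressible (d + 1) (A.erase i)
      (fun V _ G s => #{a | P V G (Function.update s i a)} = m) :=
  ((h.atLeast m i).and (h.atLeast (m + 1) i).not).congr fun V _ G s => by
    constructor
    · rintro ⟨h1, h2⟩
      omega
    · rintro rfl
      exact ⟨le_rfl, by omega⟩

end Expressible

end CountingFormula

/-! ### Colour refinement of pairs and its definability. -/

theorem Multiset.map_univ_eq_iff_card_filter {α β : Type*} [Fintype α] [DecidableEq β] (f : α → β)
    (M : Multiset β) :
    univ.val.map f = M ↔
      (∀ b ∈ M.toFinset, #{a | f a = b} = M.count b) ∧ ∀ a, ∃ b ∈ M.toFinset, f a = b := by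
  have key : ∀ b, (univ.val.map f).count b = #{a | f a = b} := by
    intro b
    rw [Multiset.count_map, Finset.card_def, Finset.filter_val]
    simp only [eq_comm]
  constructor
  · rintro rfl
    exact ⟨fun b _ => (key b).symm, fun a => ⟨f a, by simp, rfl⟩⟩
  · rintro ⟨h1, h2⟩
    ext b
    rw [key]
    by_cases hb : b ∈ M.toFinset
    · exact h1 b hb
    · rw [Multiset.count_eq_zero_of_notMem (by simpa using hb), Finset.card_eq_zero,
        Finset.filter_eq_empty_iff]
      rintro a - rfl
      obtain ⟨b, hb', hab⟩ := h2 a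
      exact hb (hab ▸ hb')

namespace SimpleGraph

variable {V W : Type*} [Fintype V] [Fintype W]

/-- The colour of the pair `(x, y)` after `r` rounds of the two-dimensional Weisfeiler-Leman
colour refinement. -/
def pairColor (G : SimpleGraph V) : ℕ → V → V → ℕ
  | 0, x, y => if x = y then 0 else if G.Adj x y then 1 else 2
  -- An injective coding independent of the graph makes colours of different graphs comparable.
  | r + 1, x, y => Denumerable.eqv (ℕ × Multiset (ℕ × ℕ))
      (G.pairColor r x y, univ.val.map fun w => (G.pairColor r x w, G.pairColor r y w))

/-- The multiset of colours of the vertices after `r` rounds. -/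
def colorMultiset (G : SimpleGraph V) (r : ℕ) : Multiset ℕ :=
  univ.val.map fun x => G.pairColor r x x

end SimpleGraph

namespace CountingFormula

theorem expressible_pairColor (r κ : ℕ) (i j : Fin 3) :
    Expressible.{u} r {i, j} (fun _ _ G s => G.pairColor r (s i) (s j) = κ) := by
  induction r generalizing κ i j with
  | zero =>
    have heq : Expressible.{u} 0 {i, j} (fun _ _ _ s => s i = s j) :=
      ⟨.eq i j, le_rfl, subset_rfl, fun V _ G s => Iff.rfl⟩
    have hadj : Expressible.{u} 0 {i, j} (fun _ _ G s => G.Adj (s i) (s j)) :=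
      ⟨.adj i j, le_rfl, subset_rfl, fun V _ G s => Iff.rfl⟩
    match κ with
    | 0 =>
      refine heq.congr fun V _ G s => ?_
      by_cases h : s i = s j <;> by_cases h' : G.Adj (s i) (s j) <;>
        simp [SimpleGraph.pairColor, h, h']
    | 1 =>
      refine hadj.congr fun V _ G s => ?_
      by_cases h : s i = s j <;> simp [SimpleGraph.pairColor, h]
    | 2 =>
      refine (heq.not.and hadj.not).congr fun V _ G s => ?_
      by_cases h : s i = s j <;> by_cases h' : G.Adj (s i) (s j) <;>
        simp [SimpleGraph.pairColor, h, h']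
    -- No pair has such a colour in round 0, so a contradiction expresses it.
    | κ + 3 =>
      refine (heq.and heq.not).congr fun V _ G s => ?_
      by_cases h : s i = s j <;> by_cases h' : G.Adj (s i) (s j) <;>
        simp [SimpleGraph.pairColor, h, h']
  | succ r ih =>
    -- The third variable holds the vertex over which the refinement step ranges; every round reuses
    -- the same three variables.
    obtain ⟨l, hli, hlj⟩ : ∃ l : Fin 3, l ≠ i ∧ l ≠ j := by decide +revert
    obtain ⟨⟨κ₀, M⟩, rfl⟩ : ∃ p : ℕ × Multiset (ℕ × ℕ), κ = Denumerable.eqv _ p :=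
      ⟨(Denumerable.eqv _).symm κ, by simp only [Equiv.apply_symm_apply]⟩
    have hsub : ({i, l} ∪ {j, l} : Finset (Fin 3)).erase l ⊆ {i, j} := by decide +revert
    have htrue : Expressible.{u} (r + 1) {i, j} (fun _ _ _ _ => True) :=
      ⟨.eq i i, by simp [depth], by simp [freeVars], fun V _ G s => by simp [Realize]⟩
    have htrue' : Expressible.{u} r ({i, l} ∪ {j, l}) (fun _ _ _ _ => True) :=
      ⟨.eq l l, by simp [depth], by simp [freeVars], fun V _ G s => by simp [Realize]⟩
    have hpair (p : ℕ × ℕ) : Expressible.{u} r ({i, l} ∪ {j, l})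
        (fun _ _ G s => (G.pairColor r (s i) (s l), G.pairColor r (s j) (s l)) = p) :=
      (((ih p.1 i l).mono le_rfl subset_union_left).and
        ((ih p.2 j l).mono le_rfl subset_union_right)).congr fun V _ G s => by
          rw [Prod.ext_iff]
    have hcount := Expressible.forall_mem htrue M.toFinset fun p _ =>
      ((hpair p).exactly (M.count p) l).mono le_rfl hsub
    have hcover := ((Expressible.exists_mem htrue' M.toFinset fun p _ => hpair p).all l).mono
      le_rfl hsub
    refine (((ih κ₀ i j).mono (Nat.le_succ r) subset_rfl).and
      (hcount.and hcover)).congr fun V _ G s => ?_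
    simp only [SimpleGraph.pairColor, Equiv.apply_eq_iff_eq, Prod.mk.injEq,
      Multiset.map_univ_eq_iff_card_filter, Function.update_self, Function.update_of_ne hli.symm,
      Function.update_of_ne hlj.symm]

theorem exists_sentence_colorMultiset (r : ℕ) (M : Multiset ℕ) :
    Expressible.{u} (k := 3) (r + 1) ∅ (fun _ _ G _ => G.colorMultiset r = M) := by
  have htrue : Expressible.{u} (k := 3) (r + 1) ∅ (fun _ _ _ _ => True) :=
    ⟨.all 0 (.eq 0 0), by simp [depth], by simp [freeVars], fun V _ G s => by simp [Realize]⟩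
  have htrue' : Expressible.{u} (k := 3) r {0, 0} (fun _ _ _ _ => True) :=
    ⟨.eq 0 0, by simp [depth], by simp [freeVars], fun V _ G s => by simp [Realize]⟩
  have hsub : ({0, 0} : Finset (Fin 3)).erase 0 ⊆ ∅ := by decide
  have hcount := Expressible.forall_mem htrue M.toFinset fun κ _ =>
      ((expressible_pairColor r κ 0 0).exactly (M.count κ) 0).mono le_rfl hsub
  have hcover := ((Expressible.exists_mem htrue' M.toFinset fun κ _ =>
    expressible_pairColor r κ 0 0).all 0).mono le_rfl hsub
  refine (hcount.and hcover).congr fun V _ G s => ?_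
  simp only [SimpleGraph.colorMultiset, Multiset.map_univ_eq_iff_card_filter,
    Function.update_self]

end CountingFormula

/-! ### What equal colours imply: counts, degrees, distances, being a tree. -/

theorem Finset.exists_injOn_of_map_eq_map {α β γ : Type*} [Nonempty β] {A : Finset α}
    {B : Finset β} {f : α → γ} {g : β → γ} (h : A.val.map f = B.val.map g) :
    ∃ σ : α → β, Set.InjOn σ A ∧ ∀ a ∈ A, σ a ∈ B ∧ g (σ a) = f a := by
  induction A using Finset.induction_on generalizing B with
  | empty => exact ⟨fun _ => Classical.arbitrary β, by simp, by simp⟩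
  | insert a A ha ih =>
    rw [insert_val_of_notMem ha, Multiset.map_cons] at h
    have hm : f a ∈ B.val.map g := h ▸ Multiset.mem_cons_self _ _
    obtain ⟨b, hb, hfb⟩ := Multiset.mem_map.1 hm
    have hB : A.val.map f = (B.erase b).val.map g := by
      have h2 : B.val = b ::ₘ (B.erase b).val := by
        rw [erase_val, Multiset.cons_erase hb]
      rw [h2, Multiset.map_cons, hfb] at h
      exact Multiset.cons_inj_right _ |>.1 h
    obtain ⟨σ, hσ, hσ'⟩ := ih hB
    have hne : ∀ c ∈ A, c ≠ a := fun c hc hca => ha (hca ▸ hc)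
    refine ⟨Function.update σ a b, ?_, ?_⟩
    · rw [coe_insert, Set.injOn_insert (by simpa using ha)]
      refine ⟨fun c hc d hd hcd => ?_, ?_⟩
      · rw [Function.update_of_ne (hne c hc), Function.update_of_ne (hne d hd)] at hcd
        exact hσ hc hd hcd
      · rintro ⟨c, hc, hcb⟩
        rw [Function.update_self, Function.update_of_ne (hne c hc)] at hcb
        exact (mem_erase.1 (hσ' c hc).1).1 hcb
    · intro c hc
      rcases mem_insert.1 hc with rfl | hc
      · simpa using ⟨hb, hfb⟩
      · rw [Function.update_of_ne (hne c hc)]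
        exact ⟨mem_of_mem_erase (hσ' c hc).1, (hσ' c hc).2⟩

theorem Finset.card_filter_le_of_map_eq_map {α β γ : Type*} {A : Finset α}
    {B : Finset β} {f : α → γ} {g : β → γ} (h : A.val.map f = B.val.map g)
    {P : α → Prop} {Q : β → Prop} (hPQ : ∀ a ∈ A, ∀ b ∈ B, f a = g b → P a → Q b) :
    #{a ∈ A | P a} ≤ #{b ∈ B | Q b} := by
  cases isEmpty_or_nonempty β with
  | inl _ =>
    have : A.val.map f = 0 := by rw [h, B.eq_empty_of_isEmpty]; rfl
    rw [Multiset.map_eq_zero, val_eq_zero] at this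
    simp [this]
  | inr _ =>
    obtain ⟨σ, hσ, hσ'⟩ := exists_injOn_of_map_eq_map h
    refine card_le_card_of_injOn σ (fun a ha => ?_) fun a ha b hb => ?_
    · have ha := mem_filter.1 (mem_coe.1 ha)
      exact mem_coe.2 (mem_filter.2 ⟨(hσ' a ha.1).1,
        hPQ a ha.1 _ (hσ' a ha.1).1 (hσ' a ha.1).2.symm ha.2⟩)
    · exact hσ (mem_coe.2 (mem_filter.1 (mem_coe.1 ha)).1) (mem_filter.1 (mem_coe.1 hb)).1

theorem Finset.card_filter_eq_of_map_eq_map {α β γ : Type*} {A : Finset α}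
    {B : Finset β} {f : α → γ} {g : β → γ} (h : A.val.map f = B.val.map g)
    {P : α → Prop} {Q : β → Prop} (hPQ : ∀ a ∈ A, ∀ b ∈ B, f a = g b → (P a ↔ Q b)) :
    #{a ∈ A | P a} = #{b ∈ B | Q b} :=
  le_antisymm
    (card_filter_le_of_map_eq_map h fun a ha b hb hab => (hPQ a ha b hb hab).1)
    (card_filter_le_of_map_eq_map h.symm fun b hb a ha hab => (hPQ a ha b hb hab.symm).2)

namespace SimpleGraph

section Color

variable {V W : Type*} [Fintype V] [Fintype W] {G : SimpleGraph V} {H : SimpleGraph W}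
  {r : ℕ} {x y : V} {x' y' : W}

theorem pairColor_succ_eq_iff :
    G.pairColor (r + 1) x y = H.pairColor (r + 1) x' y' ↔
      G.pairColor r x y = H.pairColor r x' y' ∧
        (univ.val.map fun w => (G.pairColor r x w, G.pairColor r y w)) =
          univ.val.map fun w => (H.pairColor r x' w, H.pairColor r y' w) := by
  simp only [pairColor, Equiv.apply_eq_iff_eq, Prod.mk.injEq]

theorem pairColor_eq_of_le {s : ℕ} (hs : s ≤ r)
    (h : G.pairColor r x y = H.pairColor r x' y') :
    G.pairColor s x y = H.pairColor s x' y' := by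
  induction hs with
  | refl => exact h
  | step _ ih => exact ih (pairColor_succ_eq_iff.1 h).1

theorem eq_iff_of_pairColor_eq (h : G.pairColor r x y = H.pairColor r x' y') :
    x = y ↔ x' = y' := by
  have h0 := pairColor_eq_of_le (Nat.zero_le r) h
  simp only [pairColor] at h0
  split_ifs at h0 <;> simp_all

theorem adj_iff_of_pairColor_eq (h : G.pairColor r x y = H.pairColor r x' y') :
    G.Adj x y ↔ H.Adj x' y' := by
  have h0 := pairColor_eq_of_le (Nat.zero_le r) h
  simp only [pairColor] at h0
  split_ifs at h0 <;> simp_all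

theorem pairColor_swap (h : G.pairColor r x y = H.pairColor r x' y') :
    G.pairColor r y x = H.pairColor r y' x' := by
  induction r generalizing x y x' y' with
  | zero =>
    have h1 := eq_iff_of_pairColor_eq h
    have h2 := adj_iff_of_pairColor_eq h
    simp only [pairColor, eq_comm (a := y), eq_comm (a := y'), h1, G.adj_comm y, h2,
      H.adj_comm y']
  | succ r ih =>
    rw [pairColor_succ_eq_iff] at h ⊢
    refine ⟨ih h.1, ?_⟩
    have := congrArg (Multiset.map Prod.swap) h.2
    simpa only [Multiset.map_map, Function.comp_def, Prod.swap_prod_mk] using this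

theorem exists_pairColor_eq (h : G.pairColor (r + 1) x y = H.pairColor (r + 1) x' y') (w : V) :
    ∃ w', G.pairColor r x w = H.pairColor r x' w' ∧
      G.pairColor r y w = H.pairColor r y' w' := by
  have hm : (G.pairColor r x w, G.pairColor r y w) ∈
      univ.val.map fun w => (H.pairColor r x' w, H.pairColor r y' w) := by
    rw [← (pairColor_succ_eq_iff.1 h).2]
    exact Multiset.mem_map_of_mem _ (mem_univ w)
  obtain ⟨w', -, hw'⟩ := Multiset.mem_map.1 hm
  exact ⟨w', (congrArg Prod.fst hw').symm, (congrArg Prod.snd hw').symm⟩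

theorem card_filter_eq_of_pairColor_eq
    (h : G.pairColor (r + 1) x y = H.pairColor (r + 1) x' y') {P : V → Prop} {Q : W → Prop}
    (hPQ : ∀ w w', G.pairColor r x w = H.pairColor r x' w' →
      G.pairColor r y w = H.pairColor r y' w' → (P w ↔ Q w')) :
    #{w | P w} = #{w | Q w} :=
  card_filter_eq_of_map_eq_map (pairColor_succ_eq_iff.1 h).2 fun w _ w' _ hw =>
    hPQ w w' (congrArg Prod.fst hw) (congrArg Prod.snd hw)

theorem card_neighborFinset_eq_of_pairColor_eq (hr : 1 ≤ r)
    (h : G.pairColor r x y = H.pairColor r x' y') :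
    #(G.neighborFinset x) = #(H.neighborFinset x') := by
  have := card_filter_eq_of_pairColor_eq (pairColor_eq_of_le hr h)
    (P := G.Adj x) (Q := H.Adj x') fun w w' h1 _ => adj_iff_of_pairColor_eq h1
  rwa [neighborFinset_eq_filter, neighborFinset_eq_filter]

/-- The midpoint of a walk has a counterpart that looks alike from both ends, so each round doubles
the detectable length. -/
theorem exists_walk_length_le_of_pairColor_eq {j : ℕ} (hj : j ≤ 2 ^ r)
    (h : G.pairColor r x y = H.pairColor r x' y') (hw : ∃ p : G.Walk x y, p.length ≤ j) :
    ∃ p : H.Walk x' y', p.length ≤ j := by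
  induction r generalizing x y x' y' j with
  | zero =>
    obtain ⟨p, hp⟩ := hw
    match p with
    | .nil =>
      obtain rfl := (eq_iff_of_pairColor_eq h).1 rfl
      exact ⟨.nil, by simp⟩
    | .cons hxz .nil =>
      have := (adj_iff_of_pairColor_eq h).1 hxz
      exact ⟨this.toWalk, by simpa using hp⟩
    | .cons _ (.cons _ q) =>
      simp only [Walk.length_cons] at hp
      omega
  | succ r ih =>
    obtain ⟨p, hp⟩ := hw
    obtain ⟨w', h1, h2⟩ := exists_pairColor_eq h (p.getVert (j / 2))
    rw [pow_succ] at hj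
    obtain ⟨p₁, hp₁⟩ := ih (j := j / 2) (by omega) h1 ⟨p.take (j / 2), by
      rw [Walk.take_length]; omega⟩
    obtain ⟨p₂, hp₂⟩ := ih (j := j - j / 2) (by omega) (pairColor_swap h2)
      ⟨p.drop (j / 2), by rw [Walk.drop_length]; omega⟩
    exact ⟨p₁.append p₂, by rw [Walk.length_append]; omega⟩

theorem dist_eq_of_pairColor_eq (hG : G.Connected) (hxy : G.dist x y ≤ 2 ^ r)
    (h : G.pairColor r x y = H.pairColor r x' y') : G.dist x y = H.dist x' y' := by
  obtain ⟨p, hp⟩ := hG.exists_walk_length_eq_dist x y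
  obtain ⟨q, hq⟩ := exists_walk_length_le_of_pairColor_eq hxy h ⟨p, hp.le⟩
  have hle : H.dist x' y' ≤ G.dist x y := (dist_le q).trans hq
  refine le_antisymm ?_ hle
  obtain ⟨q', hq'⟩ := q.reachable.exists_walk_length_eq_dist
  obtain ⟨p', hp'⟩ := exists_walk_length_le_of_pairColor_eq (hle.trans hxy) h.symm ⟨q', hq'.le⟩
  exact (dist_le p').trans hp'

theorem exists_pairColor_eq_of_colorMultiset_eq
    (h : G.colorMultiset r = H.colorMultiset r) (x : V) :
    ∃ x', G.pairColor r x x = H.pairColor r x' x' := by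
  have hm : G.pairColor r x x ∈ H.colorMultiset r := by
    rw [← h]
    exact Multiset.mem_map_of_mem _ (mem_univ x)
  obtain ⟨x', -, hx'⟩ := Multiset.mem_map.1 hm
  exact ⟨x', hx'.symm⟩

theorem card_eq_of_colorMultiset_eq (h : G.colorMultiset r = H.colorMultiset r) :
    Fintype.card V = Fintype.card W := by
  simpa [colorMultiset] using congrArg Multiset.card h

theorem dist_lt_card (hG : G.Connected) (x y : V) : G.dist x y < Fintype.card V := by
  obtain ⟨p, hp, hl⟩ := hG.exists_path_of_dist x y
  exact hl ▸ hp.length_lt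

/-- Walks of length at most `2 ^ k` transfer, which gives connectedness; the extra round finds the
second end of a pair from the colour of the first. Equal degree sums then give the number of edges.
-/
theorem isTree_of_colorMultiset_eq (hG : G.IsTree) {k : ℕ}
    (hk : Fintype.card V - 1 ≤ 2 ^ k) (hr : k + 1 ≤ r)
    (h : G.colorMultiset r = H.colorMultiset r) : H.IsTree := by
  have hd : ∀ x y, G.dist x y ≤ 2 ^ k := fun x y => by
    have := dist_lt_card hG.1 x y
    omega
  have hconn : H.Connected := by
    have hne : Nonempty W := by
      obtain ⟨x⟩ := hG.1.nonempty
      exact ⟨(exists_pairColor_eq_of_colorMultiset_eq h x).choose⟩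
    refine ⟨fun x' y' => ?_⟩
    obtain ⟨x, hx⟩ := exists_pairColor_eq_of_colorMultiset_eq h.symm x'
    obtain ⟨y, hy, -⟩ := exists_pairColor_eq (pairColor_eq_of_le hr hx) y'
    obtain ⟨p, hp⟩ := hG.1.exists_walk_length_eq_dist x y
    obtain ⟨q, -⟩ := exists_walk_length_le_of_pairColor_eq (hd x y) hy.symm ⟨p, hp.le⟩
    exact q.reachable
  rw [isTree_iff_connected_and_card] at hG ⊢
  refine ⟨hconn, ?_⟩
  have hdeg : ∑ x, G.degree x = ∑ x, H.degree x := by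
    have hmap : univ.val.map (fun x => G.degree x) = univ.val.map fun x => H.degree x := by
      obtain ⟨x₀⟩ := hG.1.nonempty
      obtain ⟨y₀⟩ := hconn.nonempty
      rw [← Multiset.rel_eq, Multiset.rel_map]
      have h' := h
      rw [colorMultiset, colorMultiset, ← Multiset.rel_eq, Multiset.rel_map] at h'
      refine h'.mono fun x _ x' _ hx => ?_
      rw [← card_neighborFinset_eq_degree, ← card_neighborFinset_eq_degree]
      exact card_neighborFinset_eq_of_pairColor_eq (by omega) hx
    exact congrArg Multiset.sum hmap
  rw [sum_degrees_eq_twice_card_edges, sum_degrees_eq_twice_card_edges] at hdeg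
  have hc := card_eq_of_colorMultiset_eq h
  have hG2 := hG.2
  simp only [Nat.card_eq_fintype_card, ← edgeFinset_card] at hG2 ⊢
  omega

end Color

end SimpleGraph

/-! ### Betweenness and branches in trees. -/

namespace SimpleGraph

variable {V : Type*} {T : SimpleGraph V}

/-- `y` lies on a shortest path from `p` to `z`. -/
def Between (T : SimpleGraph V) (p y z : V) : Prop := T.dist p y + T.dist y z = T.dist p z

theorem Between.symm {p y z : V} (h : T.Between p y z) : T.Between z y p := by
  unfold Between at *
  rw [T.dist_comm (u := z) (v := y), T.dist_comm (u := y) (v := p),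
    T.dist_comm (u := z) (v := p)]
  omega

theorem exists_adj_dist_add_one (hT : T.IsTree) {x y : V} (hxy : x ≠ y) :
    ∃ q, T.Adj x q ∧ T.dist q y + 1 = T.dist x y := by
  obtain ⟨p, hp⟩ := hT.1.exists_walk_length_eq_dist x y
  match p with
  | .nil => exact absurd rfl hxy
  | .cons (v := q) h p =>
    refine ⟨q, h, ?_⟩
    rw [Walk.length_cons] at hp
    have h1 := dist_le p
    have h2 : T.dist x y ≤ T.dist x q + T.dist q y := hT.1.dist_triangle
    rw [dist_eq_one_iff_adj.2 h] at h2
    omega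

theorem eq_of_adj_of_dist_add_one (hT : T.IsTree) {x y q q' : V} (hq : T.Adj x q)
    (hq' : T.Adj x q') (h : T.dist q y + 1 = T.dist x y) (h' : T.dist q' y + 1 = T.dist x y) :
    q = q' := by
  obtain ⟨p, hp⟩ := hT.1.exists_walk_length_eq_dist q y
  obtain ⟨p', hp'⟩ := hT.1.exists_walk_length_eq_dist q' y
  have h1 : (Walk.cons hq p).IsPath := Walk.isPath_of_length_eq_dist _ (by simp [hp, h])
  have h2 : (Walk.cons hq' p').IsPath := Walk.isPath_of_length_eq_dist _ (by simp [hp', h'])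
  have := (hT.2.subsingleton_path x y).elim ⟨_, h1⟩ ⟨_, h2⟩
  simp only [Subtype.mk.injEq, Walk.cons.injEq] at this
  exact this.1

/-- The neighbour of `x` on the path towards `y`. -/
def next (T : SimpleGraph V) (x y : V) : V :=
  -- In a tree the default is taken only when `x = y`.
  if h : ∃ q, T.Adj x q ∧ T.dist q y + 1 = T.dist x y then h.choose else x

theorem adj_next (hT : T.IsTree) {x y : V} (hxy : x ≠ y) : T.Adj x (T.next x y) := by
  rw [next, dif_pos (exists_adj_dist_add_one hT hxy)]
  exact (exists_adj_dist_add_one hT hxy).choose_spec.1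

theorem dist_next (hT : T.IsTree) {x y : V} (hxy : x ≠ y) :
    T.dist (T.next x y) y + 1 = T.dist x y := by
  rw [next, dif_pos (exists_adj_dist_add_one hT hxy)]
  exact (exists_adj_dist_add_one hT hxy).choose_spec.2

theorem eq_next (hT : T.IsTree) {x y q : V} (hq : T.Adj x q)
    (h : T.dist q y + 1 = T.dist x y) : q = T.next x y := by
  have hxy : x ≠ y := by
    rintro rfl
    simp at h
  exact eq_of_adj_of_dist_add_one hT hq (adj_next hT hxy) h (dist_next hT hxy)

theorem dist_pos (hT : T.IsTree) {x y : V} (hxy : x ≠ y) : 0 < T.dist x y :=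
  hT.1.pos_dist_of_ne hxy

theorem Between.dist_next (hT : T.IsTree) {p y z : V} (h : T.Between p y z) (hpy : p ≠ y) :
    T.dist (T.next p y) z + 1 = T.dist p z := by
  have h1 := SimpleGraph.dist_next hT hpy
  have h2 : T.dist (T.next p y) z ≤ T.dist (T.next p y) y + T.dist y z := hT.1.dist_triangle
  have h3 : T.dist p z ≤ T.dist p (T.next p y) + T.dist (T.next p y) z := hT.1.dist_triangle
  rw [dist_eq_one_iff_adj.2 (adj_next hT hpy)] at h3
  unfold Between at h
  omega

theorem Between.next_eq (hT : T.IsTree) {p y z : V} (h : T.Between p y z) (hpy : p ≠ y) :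
    T.next p y = T.next p z :=
  eq_next hT (adj_next hT hpy) (h.dist_next hT hpy)

theorem Between.next_left (hT : T.IsTree) {p y z : V} (h : T.Between p y z) (hpy : p ≠ y) :
    T.Between (T.next p y) y z := by
  have h1 := h.dist_next hT hpy
  have h2 := SimpleGraph.dist_next hT hpy
  unfold Between at *
  omega

theorem between_next (hT : T.IsTree) {p z : V} (hpz : p ≠ z) :
    T.Between p (T.next p z) z := by
  have h1 := dist_next hT hpz
  rw [Between, dist_eq_one_iff_adj.2 (adj_next hT hpz)]
  omega

theorem Between.trans_left (hT : T.IsTree) {p y z x : V} (h : T.Between p y z)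
    (h' : T.Between y x z) : T.Between p x z ∧ T.Between p y x := by
  have h1 : T.dist p z ≤ T.dist p x + T.dist x z := hT.1.dist_triangle
  have h2 : T.dist p x ≤ T.dist p y + T.dist y x := hT.1.dist_triangle
  unfold Between at *
  omega

theorem Between.ne_right (hT : T.IsTree) {p y z : V} (h : T.Between p y z) (hpy : p ≠ y) :
    p ≠ z := by
  rintro rfl
  have := dist_pos hT hpy
  rw [Between, dist_self] at h
  omega

theorem next_eq_next_of_adj (hT : T.IsTree) {q v w : V} (hv : q ≠ v) (hw : q ≠ w)
    (hvw : T.Adj v w) : T.next q v = T.next q w := by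
  have h1 := dist_eq_one_iff_adj.2 hvw
  have h2 := dist_eq_one_iff_adj.2 hvw.symm
  rcases hT.dist_eq_dist_add_one_of_adj q hvw with h | h
  · exact (Between.next_eq (y := w) (z := v) hT (by rw [Between]; omega) hw).symm
  · exact Between.next_eq (y := v) (z := w) hT (by rw [Between]; omega) hv

/-- Once the path towards `w` moves away from `z` it keeps doing so: the only neighbour nearer to
`z` is then the previous vertex, and stepping back would increase the distance to `w`. -/
theorem between_iff_dist_next (hT : T.IsTree) {z p w : V} (hpw : p ≠ w) :
    T.Between z p w ↔ ¬ T.dist (T.next p w) z + 1 = T.dist p z := by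
  constructor
  · intro h h1
    have h2 := dist_next hT hpw
    have h3 : T.dist z w ≤ T.dist z (T.next p w) + T.dist (T.next p w) w := hT.1.dist_triangle
    rw [Between, T.dist_comm (u := z) (v := p)] at h
    rw [T.dist_comm (u := z) (v := T.next p w)] at h3
    omega
  · intro h
    obtain ⟨n, hn⟩ : ∃ n, T.dist p w = n := ⟨_, rfl⟩
    induction n generalizing p with
    | zero => exact absurd hn (dist_pos hT hpw).ne'
    | succ n ih =>
      have h1 := dist_next hT hpw
      have hadj := adj_next hT hpw
      have h2 : T.dist z (T.next p w) = T.dist z p + 1 := by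
        have := hT.dist_eq_dist_add_one_of_adj z hadj
        rw [T.dist_comm (u := T.next p w) (v := z), T.dist_comm (u := p) (v := z)] at h
        omega
      have h3 : T.Between z (T.next p w) w := by
        by_cases hqw : T.next p w = w
        · rw [hqw, Between, dist_self, add_zero]
        · refine ih hqw ?_ (by omega)
          intro h4
          have h5 := eq_of_adj_of_dist_add_one hT hadj.symm (adj_next hT hqw) (y := z)
            (by rw [T.dist_comm (u := p) (v := z), T.dist_comm (v := z)]; omega) h4
          have h6 := dist_next hT hqw
          rw [← h5] at h6
          omega
      unfold Between at *
      omega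

/-- The vertices that are reached from `p` through its neighbour `q`. -/
def branch [Fintype V] (T : SimpleGraph V) (p q : V) : Finset V :=
  {v | T.dist q v + 1 = T.dist p v}

variable [Fintype V]

theorem mem_branch {p q v : V} : v ∈ T.branch p q ↔ T.dist q v + 1 = T.dist p v := by
  simp [branch]

theorem ne_of_mem_branch {p q v : V} (h : v ∈ T.branch p q) : p ≠ v := by
  rintro rfl
  simp [mem_branch] at h

theorem mem_branch_iff_eq_next (hT : T.IsTree) {p q v : V} (hpq : T.Adj p q) (hpv : p ≠ v) :
    v ∈ T.branch p q ↔ q = T.next p v := by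
  rw [mem_branch]
  refine ⟨eq_next hT hpq, ?_⟩
  rintro rfl
  exact dist_next hT hpv

theorem mem_branch_next (hT : T.IsTree) {p v : V} (hpv : p ≠ v) :
    v ∈ T.branch p (T.next p v) := mem_branch.2 (dist_next hT hpv)

theorem mem_branch_adj {p q : V} (hpq : T.Adj p q) : q ∈ T.branch p q := by
  rw [mem_branch, dist_self, dist_eq_one_iff_adj.2 hpq]

theorem next_of_adj (hT : T.IsTree) {p q : V} (hpq : T.Adj p q) : T.next p q = q :=
  ((mem_branch_iff_eq_next hT hpq hpq.ne).1 (mem_branch_adj hpq)).symm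

theorem mem_branch_iff_between {p q v : V} (hpq : T.Adj p q) :
    v ∈ T.branch p q ↔ T.Between p q v := by
  rw [mem_branch, Between, dist_eq_one_iff_adj.2 hpq, add_comm]

theorem notMem_branch_self {p q : V} : p ∉ T.branch p q := fun h => ne_of_mem_branch h rfl

theorem between_iff_notMem_branch (hT : T.IsTree) {z p w : V} (hpw : p ≠ w) :
    T.Between z p w ↔ z ∉ T.branch p (T.next p w) := by
  rw [mem_branch, between_iff_dist_next hT hpw]

/-- The neighbours of `p` that do not lead to `z`. -/
def neighborsAvoiding (T : SimpleGraph V) (p z : V) : Finset V :=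
  {q ∈ T.neighborFinset p | z ∉ T.branch p q}

theorem mem_neighborsAvoiding {p z q : V} :
    q ∈ T.neighborsAvoiding p z ↔ T.Adj p q ∧ z ∉ T.branch p q := by
  simp [neighborsAvoiding]

theorem mem_neighborsAvoiding_iff_ne (hT : T.IsTree) {p z q : V} (hpz : p ≠ z) :
    q ∈ T.neighborsAvoiding p z ↔ T.Adj p q ∧ q ≠ T.next p z := by
  rw [mem_neighborsAvoiding]
  exact and_congr_right fun h => not_congr (mem_branch_iff_eq_next hT h hpz)

theorem neighborsAvoiding_eq_erase (hT : T.IsTree) {p z : V} (hpz : p ≠ z) :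
    T.neighborsAvoiding p z = (T.neighborFinset p).erase (T.next p z) := by
  ext q
  rw [mem_neighborsAvoiding_iff_ne hT hpz, mem_erase, mem_neighborFinset, and_comm]

theorem neighborsAvoiding_self (p : V) :
    T.neighborsAvoiding p p = T.neighborFinset p := by
  ext q
  simp [mem_neighborsAvoiding, notMem_branch_self]

/-- The branches at `p` partition the other vertices, and `p` separates `z` from `w` exactly when
the branch of `w` omits `z`. -/
theorem card_between_eq_sum (hT : T.IsTree) (z p : V) (Q : V → Prop) [DecidablePred Q] :
    #{w | p ≠ w ∧ T.Between z p w ∧ Q w} =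
      ∑ q ∈ T.neighborsAvoiding p z, #{w ∈ T.branch p q | Q w} := by
  rw [← card_biUnion]
  · congr 1
    ext w
    simp only [mem_filter, mem_univ, true_and, mem_biUnion]
    constructor
    · rintro ⟨h1, h2, h3⟩
      exact ⟨T.next p w, mem_neighborsAvoiding.2
        ⟨adj_next hT h1, (between_iff_notMem_branch hT h1).1 h2⟩, mem_branch_next hT h1, h3⟩
    · rintro ⟨q, h1, h2, h3⟩
      obtain ⟨h4, h5⟩ := mem_neighborsAvoiding.1 h1
      have h6 := ne_of_mem_branch h2
      rw [(mem_branch_iff_eq_next hT h4 h6).1 h2, ← between_iff_notMem_branch hT h6] at h5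
      exact ⟨h6, h5, h3⟩
  · intro q hq q' hq' hne
    refine Finset.disjoint_left.2 fun w hw hw' => hne ?_
    have h1 := (mem_filter.1 hw).1
    have h2 := (mem_filter.1 hw').1
    have h6 := ne_of_mem_branch h1
    rw [(mem_branch_iff_eq_next hT (mem_neighborsAvoiding.1 hq).1 h6).1 h1,
      (mem_branch_iff_eq_next hT (mem_neighborsAvoiding.1 hq').1 h6).1 h2]

theorem card_branch_eq_sum (hT : T.IsTree) {p q : V} (hpq : T.Adj p q) (Q : V → Prop) [DecidablePred Q] :
    #{w ∈ T.branch p q | Q w} =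
      (if Q q then 1 else 0) +
        ∑ r ∈ T.neighborsAvoiding q p, #{w ∈ T.branch q r | Q w} := by
  rw [← card_between_eq_sum hT p q Q, ← card_filter_add_card_filter_not (fun w => w = q),
    filter_filter, filter_filter]
  congr 1
  · split_ifs with hQ
    · rw [card_eq_one]
      refine ⟨q, ?_⟩
      ext w
      simp only [mem_filter, mem_singleton]
      refine ⟨fun h => h.2.2, ?_⟩
      rintro rfl
      exact ⟨mem_branch_adj hpq, hQ, rfl⟩
    · rw [card_eq_zero, filter_eq_empty_iff]
      rintro w - ⟨h, rfl⟩
      exact hQ h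
  · congr 1
    ext w
    simp only [mem_filter, mem_univ, true_and, mem_branch_iff_between hpq, eq_comm (a := w)]
    tauto

theorem card_branch (hT : T.IsTree) {p q : V} (hpq : T.Adj p q) :
    #(T.branch p q) = 1 + ∑ r ∈ T.neighborsAvoiding q p, #(T.branch q r) := by
  simpa using card_branch_eq_sum hT hpq fun _ => True

theorem card_branch_lt (hT : T.IsTree) {p q r : V} (hpq : T.Adj p q)
    (hr : r ∈ T.neighborsAvoiding q p) : #(T.branch q r) < #(T.branch p q) := by
  rw [card_branch hT hpq]
  have := single_le_sum (f := fun r => #(T.branch q r)) (fun _ _ => Nat.zero_le _) hr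
  omega

theorem card_eq_one_add_sum_branch (hT : T.IsTree) (p : V) :
    Fintype.card V = 1 + ∑ q ∈ T.neighborsAvoiding p p, #(T.branch p q) := by
  have h := card_between_eq_sum hT p p fun _ => True
  rw [show ∑ q ∈ T.neighborsAvoiding p p, #(T.branch p q) = _ by simpa using h.symm, ← card_univ, ← card_erase_add_one (mem_univ p), add_comm]
  congr 2
  ext w
  simp [Between, eq_comm (a := w)]

end SimpleGraph

/-! Codes of rooted trees by natural numbers. -/

namespace TreeCode

/-- The number of vertices of the rooted tree with code `X`. -/
def size (X : ℕ) : ℕ := ((Denumerable.eqv (ℕ × Multiset ℕ)).symm X).1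

/-- The codes of the branches at the root of the rooted tree with code `X`. -/
def children (X : ℕ) : Multiset ℕ := ((Denumerable.eqv (ℕ × Multiset ℕ)).symm X).2

/-- The number of vertices of a rooted tree whose root has the branches `M`. -/
def weight (M : Multiset ℕ) : ℕ := 1 + (M.map size).sum

/-- The code of the rooted tree whose root has the branches `M`. -/
def node (M : Multiset ℕ) : ℕ := Denumerable.eqv (ℕ × Multiset ℕ) (weight M, M)

@[simp] theorem size_node (M : Multiset ℕ) : size (node M) = weight M := by simp [size, node]

@[simp] theorem children_node (M : Multiset ℕ) : children (node M) = M := by simp [children, node]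

theorem weight_cons (X : ℕ) (M : Multiset ℕ) : weight (X ::ₘ M) = size X + weight M := by
  simp only [weight, Multiset.map_cons, Multiset.sum_cons]
  omega

theorem size_lt_weight {X : ℕ} {M : Multiset ℕ} (h : X ∈ M) : size X < weight M := by
  have := Multiset.single_le_sum (fun _ _ => Nat.zero_le _) _ (Multiset.mem_map_of_mem size h)
  unfold weight
  omega

/-- The total weight of a list of multisets of codes without its last entry. -/
def coreSize (l : List (Multiset ℕ)) : ℕ := (l.dropLast.map weight).sum

/-- The number of vertices with profile `l` in the rooted tree with code `X`. -/
def profileCount : List (Multiset ℕ) → ℕ → ℕ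
  | [], _ => 0
  | M :: l, X => (if M = children X ∧ l = [] then 1 else 0) +
      ((children X).map fun Y => if (children X).erase Y = M then profileCount l Y else 0).sum

end TreeCode

open TreeCode

/-! ### Branch codes and path profiles. -/

namespace SimpleGraph

variable {V W : Type*} [Fintype V] [Fintype W] {T : SimpleGraph V} {T' : SimpleGraph W}

/-- The code of the branch at `p` through `q`, up to height `h`. -/
def truncatedCode (T : SimpleGraph V) : ℕ → V → V → ℕ
  | 0, _, _ => 0
  | h + 1, p, q => node ((T.neighborsAvoiding q p).val.map (T.truncatedCode h q))

/-- The code of the branch at `p` through `q`. -/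
def code (T : SimpleGraph V) : V → V → ℕ := T.truncatedCode (Fintype.card V)

/-- The codes of the branches at `p` that do not contain `z`. -/
def codesAvoiding (T : SimpleGraph V) (p z : V) : Multiset ℕ :=
  (T.neighborsAvoiding p z).val.map (T.code p)

/-- The codes of the branches at `y` that contain neither `p` nor `z`. -/
def sideCodes (T : SimpleGraph V) (y p z : V) : Multiset ℕ :=
  (T.neighborsAvoiding y p ∩ T.neighborsAvoiding y z).val.map (T.code y)

/-- The height only makes the recursion structural; any bound of at least the size of the branch
gives the same code. -/
theorem truncatedCode_eq_of_card_branch_le (hT : T.IsTree) {p q : V} (hpq : T.Adj p q) {h h' : ℕ}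
    (hh : #(T.branch p q) ≤ h) (hh' : #(T.branch p q) ≤ h') :
    T.truncatedCode h p q = T.truncatedCode h' p q := by
  have hpos : 0 < #(T.branch p q) := card_pos.2 ⟨q, mem_branch_adj hpq⟩
  induction h generalizing p q h' with
  | zero => omega
  | succ h ih =>
    obtain ⟨h', rfl⟩ : ∃ k, h' = k + 1 := ⟨h' - 1, by omega⟩
    simp only [truncatedCode]
    congr 1
    refine Multiset.map_congr rfl fun r hr => ?_
    have h1 := card_branch_lt hT hpq hr
    have h2 := (mem_neighborsAvoiding.1 hr).1
    exact ih h2 (by omega) (by omega) (card_pos.2 ⟨r, mem_branch_adj h2⟩)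

theorem code_eq (hT : T.IsTree) {p q : V} (hpq : T.Adj p q) :
    T.code p q = node (T.codesAvoiding q p) := by
  have hle : #(T.branch p q) ≤ Fintype.card V := card_le_univ _
  rw [code, truncatedCode_eq_of_card_branch_le hT hpq hle (hle.trans (Nat.le_succ _)),
    truncatedCode, codesAvoiding, code]

theorem size_code (hT : T.IsTree) {p q : V} (hpq : T.Adj p q) :
    size (T.code p q) = #(T.branch p q) := by
  obtain ⟨n, hn⟩ : ∃ n, #(T.branch p q) = n := ⟨_, rfl⟩
  induction n using Nat.strong_induction_on generalizing p q with
  | h n ih =>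
    rw [code_eq hT hpq, size_node, weight, codesAvoiding, Multiset.map_map, card_branch hT hpq]
    congr 1
    exact sum_congr rfl fun r hr => ih _ (hn ▸ card_branch_lt hT hpq hr)
      (mem_neighborsAvoiding.1 hr).1 rfl

theorem weight_codesAvoiding_self (hT : T.IsTree) (p : V) :
    weight (T.codesAvoiding p p) = Fintype.card V := by
  rw [card_eq_one_add_sum_branch hT p, weight, codesAvoiding, Multiset.map_map]
  congr 1
  exact sum_congr rfl fun q hq => size_code hT (mem_neighborsAvoiding.1 hq).1

theorem mem_codesAvoiding {p z : V} {X : ℕ} :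
    X ∈ T.codesAvoiding p z ↔ ∃ q ∈ T.neighborsAvoiding p z, T.code p q = X := by
  simp [codesAvoiding]

theorem size_pos_of_mem_codesAvoiding (hT : T.IsTree) {p z : V} {X : ℕ}
    (hX : X ∈ T.codesAvoiding p z) : 0 < size X := by
  obtain ⟨q, hq, rfl⟩ := mem_codesAvoiding.1 hX
  have := (mem_neighborsAvoiding.1 hq).1
  rw [size_code hT this]
  exact card_pos.2 ⟨q, mem_branch_adj this⟩

theorem codesAvoiding_congr (hT : T.IsTree) {y p z : V} (hp : y ≠ p) (hz : y ≠ z)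
    (h : T.next y p = T.next y z) : T.codesAvoiding y p = T.codesAvoiding y z := by
  rw [codesAvoiding, codesAvoiding, neighborsAvoiding_eq_erase hT hp,
    neighborsAvoiding_eq_erase hT hz, h]

theorem sideCodes_congr (hT : T.IsTree) {y p z z' : V} (hz : y ≠ z) (hz' : y ≠ z')
    (h : T.next y z = T.next y z') : T.sideCodes y p z = T.sideCodes y p z' := by
  rw [sideCodes, sideCodes, neighborsAvoiding_eq_erase hT hz,
    neighborsAvoiding_eq_erase hT hz', h]

theorem sideCodes_congr_left (hT : T.IsTree) {y p p' z : V} (hp : y ≠ p) (hp' : y ≠ p')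
    (h : T.next y p = T.next y p') : T.sideCodes y p z = T.sideCodes y p' z := by
  rw [sideCodes, sideCodes, neighborsAvoiding_eq_erase hT hp,
    neighborsAvoiding_eq_erase hT hp', h]

/-- With `z = y` no second direction is excluded. Hence the last entry of a profile records
everything at the end vertex that lies away from `p`. -/
theorem sideCodes_self (y p : V) : T.sideCodes y p y = T.codesAvoiding y p := by
  rw [sideCodes, codesAvoiding, neighborsAvoiding_self, inter_eq_left.2]
  intro q hq
  exact (mem_neighborFinset _ _ _).2 (mem_neighborsAvoiding.1 hq).1

theorem codesAvoiding_eq_cons (hT : T.IsTree) {p y z : V} (h : T.Between p y z) (hyz : y ≠ z) :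
    T.codesAvoiding y p = T.code y (T.next y z) ::ₘ T.sideCodes y p z := by
  have hmem : T.next y z ∈ T.neighborsAvoiding y p :=
    mem_neighborsAvoiding.2 ⟨adj_next hT hyz, (between_iff_notMem_branch hT hyz).1 h⟩
  have : T.neighborsAvoiding y p ∩ T.neighborsAvoiding y z =
      (T.neighborsAvoiding y p).erase (T.next y z) := by
    ext q
    simp only [mem_inter, mem_neighborsAvoiding_iff_ne hT hyz, mem_erase, mem_neighborsAvoiding]
    tauto
  rw [sideCodes, this, codesAvoiding, ← Multiset.map_cons, erase_val, Multiset.cons_erase hmem]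

/-- The codes of the branches along the path from `p` to `w`, excluding those at `p`,
up to length `n`. -/
def truncatedProfile (T : SimpleGraph V) : ℕ → V → V → List (Multiset ℕ)
  | 0, _, _ => []
  | n + 1, p, w => T.sideCodes (T.next p w) p w :: T.truncatedProfile n (T.next p w) w

/-- The multisets of codes of the side branches at the vertices of the path from `p` to `w`
other than `p`. -/
def profile (T : SimpleGraph V) (p w : V) : List (Multiset ℕ) :=
  T.truncatedProfile (T.dist p w) p w

@[simp] theorem profile_self (p : V) : T.profile p p = [] := by
  simp [profile, truncatedProfile]

theorem profile_of_ne (hT : T.IsTree) {p w : V} (h : p ≠ w) :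
    T.profile p w = T.sideCodes (T.next p w) p w :: T.profile (T.next p w) w := by
  rw [profile, ← dist_next hT h, truncatedProfile, profile]

theorem profile_eq_nil (hT : T.IsTree) {p w : V} : T.profile p w = [] ↔ p = w := by
  constructor
  · intro h
    by_contra hne
    rw [profile_of_ne hT hne] at h
    exact List.cons_ne_nil _ _ h
  · rintro rfl
    exact profile_self p

/-- As an end vertex `y` contributes the branch towards `z` as well, as an inner vertex it does not;
hence the entry of `y` is dropped and replaced. -/
theorem profile_split (hT : T.IsTree) {p y z : V} (hpy : p ≠ y) (h : T.Between p y z) :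
    T.profile p z = (T.profile p y).dropLast ++ T.sideCodes y p z :: T.profile y z := by
  obtain ⟨n, hn⟩ : ∃ n, T.dist p y = n := ⟨_, rfl⟩
  induction n generalizing p with
  | zero => exact absurd hn (dist_pos hT hpy).ne'
  | succ n ih =>
    have hpz := h.ne_right hT hpy
    have hnext := h.next_eq hT hpy
    rw [profile_of_ne hT hpz, profile_of_ne hT hpy, ← hnext]
    by_cases hq : T.next p y = y
    · rw [hq, profile_self]
      rfl
    · have hd := dist_next hT hpy
      have hb := h.next_left hT hpy
      rw [List.dropLast_cons_of_ne_nil (fun h0 => hq ((profile_eq_nil hT).1 h0)),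
        ih hq hb (by omega), List.cons_append,
        sideCodes_congr hT hq (hb.ne_right hT hq) (hb.next_eq hT hq)]
      congr 3
      refine sideCodes_congr_left hT (Ne.symm hq) hpy.symm ?_
      exact (between_next hT hpy).symm.next_eq hT (Ne.symm hq)

theorem profile_eq_dropLast_append (hT : T.IsTree) {p z : V} (hpz : p ≠ z) :
    T.profile p z = (T.profile p z).dropLast ++ [T.codesAvoiding z p] := by
  have := profile_split hT hpz (z := z) (by simp [Between])
  rwa [profile_self, sideCodes_self] at this

theorem coreSize_profile_split (hT : T.IsTree) {p y z : V} (hpy : p ≠ y) (hyz : y ≠ z)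
    (h : T.Between p y z) :
    coreSize (T.profile p z) =
      coreSize (T.profile p y) + weight (T.sideCodes y p z) + coreSize (T.profile y z) := by
  have hne : T.profile y z ≠ [] := fun h0 => hyz ((profile_eq_nil hT).1 h0)
  rw [coreSize, profile_split hT hpy h, List.dropLast_append_of_ne_nil (by simp),
    List.dropLast_cons_of_ne_nil hne]
  simp [coreSize, add_assoc]

/-- The branch is rebuilt from its far end: the last entry gives the subtree at `w`, and each
earlier vertex adds its side branches to the part already known. -/
theorem code_next_eq_of_profile_eq (hT : T.IsTree) (hT' : T'.IsTree) {p w : V} {p' w' : W}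
    (hpw : p ≠ w) (h : T.profile p w = T'.profile p' w') :
    T.code p (T.next p w) = T'.code p' (T'.next p' w') := by
  obtain ⟨n, hn⟩ : ∃ n, T.dist p w = n := ⟨_, rfl⟩
  induction n generalizing p p' with
  | zero => exact absurd hn (dist_pos hT hpw).ne'
  | succ n ih =>
    have hpw' : p' ≠ w' := by
      rintro rfl
      rw [profile_self, profile_eq_nil hT] at h
      exact hpw h
    rw [code_eq hT (adj_next hT hpw), code_eq hT' (adj_next hT' hpw')]
    congr 1
    rw [profile_of_ne hT hpw, profile_of_ne hT' hpw'] at h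
    obtain ⟨h1, h2⟩ := List.cons.inj h
    by_cases hq : T.next p w = w
    · have hq' : T'.next p' w' = w' := by
        rw [hq, profile_self, eq_comm, profile_eq_nil hT'] at h2
        exact h2
      rw [hq, hq', sideCodes_self, sideCodes_self] at h1
      rw [hq, hq', h1]
    · have hq' : T'.next p' w' ≠ w' := by
        intro h0
        rw [h0, profile_self, profile_eq_nil hT] at h2
        exact hq h2
      have hd := dist_next hT hpw
      rw [codesAvoiding_eq_cons hT (between_next hT hpw) hq,
        codesAvoiding_eq_cons hT' (between_next hT' hpw') hq', h1, ih hq h2 (by omega)]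

theorem size_code_next (hT : T.IsTree) {p w : V} (hpw : p ≠ w) :
    size (T.code p (T.next p w)) =
      coreSize (T.profile p w) + weight (T.codesAvoiding w p) := by
  suffices h : size (T.code p (T.next p w)) = ((T.profile p w).map weight).sum by
    rw [h]
    conv_lhs => rw [profile_eq_dropLast_append hT hpw]
    simp [coreSize]
  obtain ⟨n, hn⟩ : ∃ n, T.dist p w = n := ⟨_, rfl⟩
  induction n generalizing p with
  | zero => exact absurd hn (dist_pos hT hpw).ne'
  | succ n ih =>
    rw [code_eq hT (adj_next hT hpw), size_node, profile_of_ne hT hpw]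
    by_cases hq : T.next p w = w
    · simp [hq, sideCodes_self]
    · have hd := dist_next hT hpw
      rw [codesAvoiding_eq_cons hT (between_next hT hpw) hq, weight_cons, ih hq (by omega),
        List.map_cons, List.sum_cons, add_comm]

theorem card_profile_eq (hT : T.IsTree) {p q : V} (hpq : T.Adj p q) (l : List (Multiset ℕ)) :
    #{w ∈ T.branch p q | T.profile p w = l} = profileCount l (T.code p q) := by
  induction l generalizing p q with
  | nil =>
    rw [profileCount, card_eq_zero, filter_eq_empty_iff]
    intro w hw h
    exact ne_of_mem_branch hw ((profile_eq_nil hT).1 h)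
  | cons M l ih =>
    rw [card_branch_eq_sum hT hpq, profileCount, code_eq hT hpq, children_node]
    congr 1
    · rw [profile_of_ne hT hpq.ne, next_of_adj hT hpq, profile_self, sideCodes_self]
      simp only [List.cons.injEq, eq_comm (a := M), eq_comm (a := l)]
    · conv_rhs => rw [codesAvoiding, Multiset.map_map, ← codesAvoiding]
      refine sum_congr rfl fun r hr => ?_
      have hqr := (mem_neighborsAvoiding.1 hr).1
      have key : ∀ w ∈ T.branch q r, (T.profile p w = M :: l ↔
          (T.codesAvoiding q p).erase (T.code q r) = M ∧ T.profile q w = l) := by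
        intro w hw
        have hqw := ne_of_mem_branch hw
        have hr' := (mem_branch_iff_eq_next hT hqr hqw).1 hw
        have hb : T.Between p q w := by
          rw [between_iff_notMem_branch hT hqw, ← hr']
          exact (mem_neighborsAvoiding.1 hr).2
        have hpw := hb.ne_right hT hpq.ne
        have hq : T.next p w = q := by
          rw [← hb.next_eq hT hpq.ne, next_of_adj hT hpq]
        rw [profile_of_ne hT hpw, hq, List.cons.injEq, codesAvoiding_eq_cons hT hb hqw, ← hr',
          Multiset.erase_cons_head]
      rw [filter_congr key]
      simp only [Function.comp]
      split_ifs with hM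
      · simp only [hM, true_and, ih hqr]
      · simp [hM]

/-- Vertices with the reference profile lie only in branches with the reference code, and all these
branches contain equally many. A multiplicity of codes thus becomes a count of vertices. -/
theorem count_codesAvoiding_mul (hT : T.IsTree) (hT' : T'.IsTree) {u w₀ : W}
    (p z : V) :
    (T.codesAvoiding p z).count (T'.code u (T'.next u w₀)) *
        profileCount (T'.profile u w₀) (T'.code u (T'.next u w₀)) =
      #{w | p ≠ w ∧ T.Between z p w ∧ T.profile p w = T'.profile u w₀} := by
  rw [card_between_eq_sum hT, codesAvoiding, Multiset.count_map, ← filter_val, ← card_def,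
    card_eq_sum_ones, sum_mul, sum_filter]
  refine sum_congr rfl fun q hq => ?_
  have hpq := (mem_neighborsAvoiding.1 hq).1
  split_ifs with h
  · rw [card_profile_eq hT hpq, h, one_mul]
  · symm
    rw [card_eq_zero, filter_eq_empty_iff]
    intro w hw hp
    have hpw := ne_of_mem_branch hw
    refine h ?_
    rw [← code_next_eq_of_profile_eq hT hT' hpw hp, ← (mem_branch_iff_eq_next hT hpq hpw).1 hw]

theorem profileCount_pos (hT : T.IsTree) {p w : V} (hpw : p ≠ w) :
    0 < profileCount (T.profile p w) (T.code p (T.next p w)) := by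
  rw [← card_profile_eq hT (adj_next hT hpw)]
  exact card_pos.2 ⟨w, mem_filter.2 ⟨mem_branch_next hT hpw, rfl⟩⟩

end SimpleGraph

/-- Used with `P` a size bound: if all branches on one side are small and their multiplicities
match, equal degrees leave no room for a large branch on the other side. -/
theorem Multiset.eq_of_count_eq_of_card_eq {α : Type*} [DecidableEq α] {s t : Multiset α}
    {P : α → Prop} (hs : ∀ a ∈ s, P a) (hcount : ∀ a, P a → s.count a = t.count a)
    (hcard : s.card = t.card) : s = t := by
  refine Multiset.eq_of_le_of_card_le (Multiset.le_iff_count.2 fun a => ?_) hcard.ge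
  by_cases ha : a ∈ s
  · exact (hcount a (hs a ha)).le
  · rw [Multiset.count_eq_zero_of_notMem ha]
    exact Nat.zero_le _

namespace SimpleGraph

/-! ### Centroids and medians. -/

section Separators

variable {V : Type*} [Fintype V] {T : SimpleGraph V}

theorem size_code_of_mem_neighborsAvoiding (hT : T.IsTree) {w p r : V}
    (hr : r ∈ T.neighborsAvoiding w p) :
    T.Between p w r ∧ size (T.code w r) = weight (T.codesAvoiding r p) := by
  obtain ⟨hwr, hp⟩ := mem_neighborsAvoiding.1 hr
  have hb : T.Between p w r := by
    rwa [between_iff_notMem_branch hT hwr.ne, next_of_adj hT hwr]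
  refine ⟨hb, ?_⟩
  rw [code_eq hT hwr, size_node, codesAvoiding_congr hT hwr.ne'
    (hb.symm.ne_right hT hwr.ne') (hb.symm.next_eq hT hwr.ne')]

/-- `w` has the smallest subtree still exceeding half the branch. Less than half is left before `w`,
and a branch beyond `w` exceeding half would contradict minimality. -/
theorem exists_centroid_of_branch (hT : T.IsTree) {p q : V} (hpq : T.Adj p q) :
    ∃ w ∈ T.branch p q, 2 * coreSize (T.profile p w) ≤ size (T.code p q) ∧
      ∀ Y ∈ T.codesAvoiding w p, 2 * size Y ≤ size (T.code p q) := by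
  let S : Finset V :=
    {w ∈ T.branch p q | size (T.code p q) < 2 * weight (T.codesAvoiding w p)}
  have hS : S.Nonempty := by
    refine ⟨q, mem_filter.2 ⟨mem_branch_adj hpq, ?_⟩⟩
    rw [code_eq hT hpq, size_node]
    have : 0 < weight (T.codesAvoiding q p) := by unfold weight; omega
    omega
  obtain ⟨w, hw, hmin⟩ := S.exists_min_image (fun w => weight (T.codesAvoiding w p)) hS
  obtain ⟨hwb, hws⟩ := mem_filter.1 hw
  have hpw := ne_of_mem_branch hwb
  have hq := (mem_branch_iff_eq_next hT hpq hpw).1 hwb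
  refine ⟨w, hwb, ?_, fun Y hY => ?_⟩
  · have := size_code_next hT hpw
    rw [← hq] at this
    omega
  · obtain ⟨r, hr, rfl⟩ := mem_codesAvoiding.1 hY
    have hlt := size_lt_weight hY
    obtain ⟨hb, hsize⟩ := size_code_of_mem_neighborsAvoiding hT hr
    by_contra hlarge
    have hpr := hb.ne_right hT hpw
    have hrS : r ∈ S := by
      refine mem_filter.2 ⟨?_, by omega⟩
      rw [mem_branch_iff_eq_next hT hpq hpr, ← hb.next_eq hT hpw, hq]
    have := hmin r hrS
    omega

theorem exists_centroid (hT : T.IsTree) :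
    ∃ x, ∀ Y ∈ T.codesAvoiding x x, 2 * size Y ≤ Fintype.card V := by
  obtain ⟨p⟩ := hT.1.nonempty
  let S : Finset V := {w | Fintype.card V < 2 * weight (T.codesAvoiding w p)}
  have hS : S.Nonempty := by
    refine ⟨p, mem_filter.2 ⟨mem_univ _, ?_⟩⟩
    rw [weight_codesAvoiding_self hT]
    have : 0 < Fintype.card V := Fintype.card_pos_iff.2 ⟨p⟩
    omega
  obtain ⟨w, hw, hmin⟩ := S.exists_min_image (fun w => weight (T.codesAvoiding w p)) hS
  have hws := (mem_filter.1 hw).2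
  refine ⟨w, fun Y hY => ?_⟩
  obtain ⟨r, hr, rfl⟩ := mem_codesAvoiding.1 hY
  have hwr := (mem_neighborsAvoiding.1 hr).1
  by_cases hp : p ∈ T.branch w r
  -- The branch back to the auxiliary root `p` is the complement of a subtree that exceeds half.
  · have hwp := ne_of_mem_branch hp
    have hr' := (mem_branch_iff_eq_next hT hwr hwp).1 hp
    have hcons := codesAvoiding_eq_cons hT (p := w) (y := w) (z := p) (by simp [Between]) hwp
    have hside : T.sideCodes w w p = T.codesAvoiding w p := by
      rw [← sideCodes_self, sideCodes, sideCodes, inter_comm]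
    have hn := weight_codesAvoiding_self hT w
    rw [hcons, weight_cons, hside, ← hr'] at hn
    omega
  · have hr' : r ∈ T.neighborsAvoiding w p := mem_neighborsAvoiding.2 ⟨hwr, hp⟩
    have hlt := size_lt_weight (mem_codesAvoiding.2 ⟨r, hr', rfl⟩)
    obtain ⟨hb, hsize⟩ := size_code_of_mem_neighborsAvoiding hT hr'
    by_contra hlarge
    have := hmin r (mem_filter.2 ⟨mem_univ _, by omega⟩)
    omega

theorem coreSize_profile_of_adj (hT : T.IsTree) {p z : V} (h : T.Adj p z) :
    coreSize (T.profile p z) = 0 := by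
  rw [profile_of_ne hT h.ne, next_of_adj hT h, profile_self]
  rfl

/-- Take the farthest `y` whose first part is at most half. If the second part exceeded half, the
next vertex would also qualify. Side branches are smaller than the total because `y` itself is
counted. -/
theorem exists_median (hT : T.IsTree) {p z : V} (hpz : p ≠ z)
    (hpos : 0 < coreSize (T.profile p z)) :
    ∃ y, p ≠ y ∧ y ≠ z ∧ T.Between p y z ∧
      2 * coreSize (T.profile p y) ≤ coreSize (T.profile p z) ∧
      2 * coreSize (T.profile y z) ≤ coreSize (T.profile p z) ∧
      ∀ X ∈ T.sideCodes y p z, size X < coreSize (T.profile p z) := by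
  let S : Finset V := {y | p ≠ y ∧ y ≠ z ∧ T.Between p y z ∧
    2 * coreSize (T.profile p y) ≤ coreSize (T.profile p z)}
  have hadj := adj_next hT hpz
  have hS : S.Nonempty := by
    refine ⟨T.next p z, mem_filter.2 ⟨mem_univ _, hadj.ne, ?_, between_next hT hpz, ?_⟩⟩
    · intro h
      rw [h] at hadj
      rw [coreSize_profile_of_adj hT hadj] at hpos
      exact hpos.false
    · rw [coreSize_profile_of_adj hT hadj]
      omega
  obtain ⟨y, hy, hmax⟩ := S.exists_max_image (fun y => T.dist p y) hS
  obtain ⟨hpy, hyz, hb, hcore⟩ := (mem_filter.1 hy).2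
  have hsplit := coreSize_profile_split hT hpy hyz hb
  refine ⟨y, hpy, hyz, hb, hcore, ?_, fun X hX => ?_⟩
  · have hadj' := adj_next hT hyz
    by_cases hn : T.next y z = z
    · rw [hn] at hadj'
      rw [coreSize_profile_of_adj hT hadj']
      omega
    · obtain ⟨h1, h2⟩ := hb.trans_left hT (between_next hT hyz)
      have hd : T.dist p y + 1 = T.dist p (T.next y z) := by
        rw [← dist_eq_one_iff_adj.2 hadj']
        exact h2
      have hsplit' := coreSize_profile_split hT hpy hadj'.ne h2
      have hside := sideCodes_congr hT (p := p) hadj'.ne hyz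
        (next_of_adj hT hadj')
      rw [hside, coreSize_profile_of_adj hT hadj'] at hsplit'
      by_contra hlarge
      have := hmax (T.next y z) (mem_filter.2 ⟨mem_univ _, h2.ne_right hT hpy, hn, h1, by omega⟩)
      omega
  · have := size_lt_weight hX
    omega

end Separators

/-! ### The interlocking recursion for branches and paths. -/

section Agreement

/-- The number of rounds that suffices to compare branches with at most `b` vertices, if `e`
rounds determine all distances. -/
def branchRounds (e b : ℕ) : ℕ :=
  if b = 0 then 0 else 2 * Nat.log 2 b + e + if b = 1 then 1 else 0

/-- The number of rounds that suffices to compare paths whose inner vertices carry at most `m`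
vertices, if `e` rounds determine all distances. -/
def pathRounds (e m : ℕ) : ℕ := if m = 0 then 0 else 2 * Nat.log 2 m + 1 + e

theorem log_two_half {b : ℕ} (hb : 2 ≤ b) : Nat.log 2 b = Nat.log 2 (b / 2) + 1 :=
  Nat.log_of_one_lt_of_le (by norm_num) hb

/-- The recursion through a centroid costs one round. For `b = 1` the halves need no rounds but
distances still need `e`, whence the extra summand in `branchRounds`. -/
theorem lt_branchRounds (e : ℕ) {b : ℕ} (hb : 0 < b) :
    branchRounds e (b / 2) < branchRounds e b ∧ pathRounds e (b / 2) < branchRounds e b ∧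
      e < branchRounds e b := by
  unfold branchRounds pathRounds
  rcases (show b = 1 ∨ b = 2 ∨ b = 3 ∨ 4 ≤ b by omega) with rfl | rfl | rfl | h
  · simp
  · simp [log_two_half]
    omega
  · simp [log_two_half]
    omega
  · have h1 := log_two_half (b := b) (by omega)
    have h2 := log_two_half (b := b / 2) (by omega)
    rw [if_neg (by omega), if_neg (by omega), if_neg (by omega), if_neg (by omega),
      if_neg (by omega)]
    omega

/-- The recursion through a median costs one round. Side branches of size `m - 1` may have the same
logarithm as `m`; the `+ 1` in `pathRounds` pays for them. -/
theorem lt_pathRounds (e : ℕ) {m : ℕ} (hm : 0 < m) :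
    pathRounds e (m / 2) < pathRounds e m ∧ branchRounds e (m - 1) < pathRounds e m ∧
      e < pathRounds e m := by
  unfold branchRounds pathRounds
  rcases (show m = 1 ∨ m = 2 ∨ 3 ≤ m by omega) with rfl | rfl | h
  · simp
  · simp [log_two_half]
    omega
  · have h1 := log_two_half (b := m) (by omega)
    have h2 : Nat.log 2 (m - 1) ≤ Nat.log 2 m := Nat.log_mono_right (by omega)
    rw [if_neg (by omega), if_neg (by omega), if_neg (by omega), if_neg (by omega)]
    omega

variable {V W : Type*} [Fintype V] [Fintype W]

/-- Enough rounds of colour refinement determine the numbers of branches with a given code of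
size at most `b`. -/
def BranchesAgree (T : SimpleGraph V) (T' : SimpleGraph W) (e b : ℕ) : Prop :=
  ∀ ⦃r : ℕ⦄ ⦃p z : V⦄ ⦃p' z' : W⦄, branchRounds e b ≤ r →
    T.pairColor r p z = T'.pairColor r p' z' →
    ∀ X, size X ≤ b → (T.codesAvoiding p z).count X = (T'.codesAvoiding p' z').count X

/-- Enough rounds of colour refinement determine the profiles of paths whose inner vertices
carry at most `m` vertices. -/
def PathsAgree (T : SimpleGraph V) (T' : SimpleGraph W) (e m : ℕ) : Prop :=
  ∀ ⦃r : ℕ⦄ ⦃p z : V⦄ ⦃p' z' : W⦄, pathRounds e m ≤ r →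
    T.pairColor r p z = T'.pairColor r p' z' → p ≠ z →
    T.codesAvoiding z p = T'.codesAvoiding z' p' → coreSize (T.profile p z) ≤ m →
    T.profile p z = T'.profile p' z'

variable {T : SimpleGraph V} {T' : SimpleGraph W} {e : ℕ}

theorem BranchesAgree.symm {b : ℕ} (h : BranchesAgree T T' e b) : BranchesAgree T' T e b :=
  fun _ _ _ _ _ hr hc X hX => (h hr hc.symm X hX).symm

theorem card_codesAvoiding_eq (hT : T.IsTree) (hT' : T'.IsTree) {r : ℕ} (hr : 1 ≤ r)
    {w p : V} {w' p' : W} (h : T.pairColor r w p = T'.pairColor r w' p') :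
    (T.codesAvoiding w p).card = (T'.codesAvoiding w' p').card := by
  have hdeg := card_neighborFinset_eq_of_pairColor_eq hr h
  have hiff := eq_iff_of_pairColor_eq h
  rw [codesAvoiding, codesAvoiding, Multiset.card_map, Multiset.card_map, ← card_def, ← card_def]
  by_cases hwp : w = p
  · obtain rfl := hwp
    obtain rfl := hiff.1 rfl
    rw [neighborsAvoiding_self, neighborsAvoiding_self, hdeg]
  · have hwp' : w' ≠ p' := fun h0 => hwp (hiff.2 h0)
    rw [neighborsAvoiding_eq_erase hT hwp, neighborsAvoiding_eq_erase hT' hwp',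
      card_erase_of_mem ((mem_neighborFinset _ _ _).2 (adj_next hT hwp)),
      card_erase_of_mem ((mem_neighborFinset _ _ _).2 (adj_next hT' hwp')), hdeg]

theorem BranchesAgree.codesAvoiding_eq (hT : T.IsTree) (hT' : T'.IsTree) {b : ℕ}
    (hA : BranchesAgree T T' e b) {r : ℕ} (hr : 1 ≤ r) (hbr : branchRounds e b ≤ r)
    {w p : V} {w' p' : W} (h : T.pairColor r w p = T'.pairColor r w' p')
    (hsmall : ∀ X ∈ T.codesAvoiding w p, size X ≤ b) :
    T.codesAvoiding w p = T'.codesAvoiding w' p' :=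
  Multiset.eq_of_count_eq_of_card_eq hsmall (hA hbr h) (card_codesAvoiding_eq hT hT' hr h)

theorem codesAvoiding_eq_of_profile_eq (hT : T.IsTree) (hT' : T'.IsTree) {p w : V} {p' w' : W}
    (hpw : p ≠ w) (hpw' : p' ≠ w') (h : T.profile p w = T'.profile p' w') :
    T.codesAvoiding w p = T'.codesAvoiding w' p' := by
  have h1 := profile_eq_dropLast_append hT hpw
  rw [h, profile_eq_dropLast_append hT' hpw'] at h1
  simpa using h1.symm

theorem between_iff_of_pairColor_eq (hT : T.IsTree) (he : ∀ x y, T.dist x y ≤ 2 ^ e) {r : ℕ}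
    (hr : e ≤ r) {p y z : V} {p' y' z' : W} (h1 : T.pairColor r p y = T'.pairColor r p' y')
    (h2 : T.pairColor r y z = T'.pairColor r y' z')
    (h3 : T.pairColor r p z = T'.pairColor r p' z') :
    T.Between p y z ↔ T'.Between p' y' z' := by
  have hle : ∀ x y, T.dist x y ≤ 2 ^ r := fun x y =>
    (he x y).trans (Nat.pow_le_pow_right (by norm_num) hr)
  rw [Between, Between, dist_eq_of_pairColor_eq hT.1 (hle _ _) h1,
    dist_eq_of_pairColor_eq hT.1 (hle _ _) h2, dist_eq_of_pairColor_eq hT.1 (hle _ _) h3]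

theorem profile_eq_of_agree (hT : T.IsTree) (hT' : T'.IsTree) {b r : ℕ} (hr : 1 ≤ r)
    (hA : BranchesAgree T T' e b) (hB : PathsAgree T T' e b)
    (hbr : branchRounds e b ≤ r) (hpr : pathRounds e b ≤ r)
    {p w : V} {p' w' : W} (h : T.pairColor r p w = T'.pairColor r p' w') (hpw : p ≠ w)
    (hcore : coreSize (T.profile p w) ≤ b) (hsmall : ∀ X ∈ T.codesAvoiding w p, size X ≤ b) :
    T.profile p w = T'.profile p' w' :=
  hB hpr h hpw (hA.codesAvoiding_eq hT hT' hr hbr (pairColor_swap h) hsmall) hcore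

theorem count_codesAvoiding_eq_of_mem (hT : T.IsTree) (hT' : T'.IsTree) (he1 : 1 ≤ e)
    (he : ∀ x y, T.dist x y ≤ 2 ^ e) {b : ℕ} (hA : BranchesAgree T T' e (b / 2))
    (hB : PathsAgree T T' e (b / 2)) (hB' : PathsAgree T' T e (b / 2)) {r : ℕ} {p z : V}
    {p' z' : W} (hr : branchRounds e b ≤ r) (h : T.pairColor r p z = T'.pairColor r p' z')
    {X : ℕ} (hX : size X ≤ b) (hmem : X ∈ T.codesAvoiding p z) :
    (T.codesAvoiding p z).count X = (T'.codesAvoiding p' z').count X := by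
  have hXpos := size_pos_of_mem_codesAvoiding hT hmem
  obtain ⟨q, hq, rfl⟩ := mem_codesAvoiding.1 hmem
  have hpq := (mem_neighborsAvoiding.1 hq).1
  obtain ⟨w₀, hw₀, hcore, hsmall⟩ := exists_centroid_of_branch hT hpq
  have hpw₀ := ne_of_mem_branch hw₀
  have hq' := (mem_branch_iff_eq_next hT hpq hpw₀).1 hw₀
  obtain ⟨h1, h2, h3⟩ := lt_branchRounds e (b := b) (by omega)
  obtain ⟨r, rfl⟩ : ∃ s, r = s + 1 := ⟨r - 1, by omega⟩
  -- The last round counts the vertices that share the profile of the centroid `w₀`.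
  have hcard := card_filter_eq_of_pairColor_eq h
    (P := fun w => p ≠ w ∧ T.Between z p w ∧ T.profile p w = T.profile p w₀)
    (Q := fun w => p' ≠ w ∧ T'.Between z' p' w ∧ T'.profile p' w = T.profile p w₀) ?_
  · have e1 := count_codesAvoiding_mul hT hT (u := p) (w₀ := w₀) p z
    have e2 := count_codesAvoiding_mul hT' hT (u := p) (w₀ := w₀) p' z'
    have hmul : (T.codesAvoiding p z).count (T.code p (T.next p w₀)) *
          profileCount (T.profile p w₀) (T.code p (T.next p w₀)) =
        (T'.codesAvoiding p' z').count (T.code p (T.next p w₀)) *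
          profileCount (T.profile p w₀) (T.code p (T.next p w₀)) := by
      rw [e1, e2]
      convert hcard
    rw [hq']
    exact Nat.eq_of_mul_eq_mul_right (profileCount_pos hT hpw₀) hmul
  · intro w w' hpw hzw
    have hne : p ≠ w ↔ p' ≠ w' := not_congr (eq_iff_of_pairColor_eq hpw)
    have hbet := between_iff_of_pairColor_eq hT he (by omega)
      (pairColor_swap (pairColor_eq_of_le (Nat.le_succ r) h)) hpw hzw
    rw [← hne, ← hbet]
    refine and_congr_right fun hpw' => and_congr_right fun _ => ?_
    constructor
    · intro hprof
      rw [← hprof]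
      symm
      refine profile_eq_of_agree hT hT' (by omega) hA hB (by omega) (by omega) hpw hpw' ?_ ?_
      · rw [hprof]
        omega
      · rw [codesAvoiding_eq_of_profile_eq hT hT hpw' hpw₀ hprof]
        intro Y hY
        have := hsmall Y hY
        omega
    -- Smallness is known only on the side whose profile is that of `w₀`, so here paths are compared
    -- from `T'` to `T`.
    · intro hprof
      rw [← hprof]
      symm
      refine profile_eq_of_agree hT' hT (by omega) hA.symm hB' (by omega) (by omega) hpw.symm
        (hne.1 hpw') ?_ ?_
      · rw [hprof]
        omega
      · rw [codesAvoiding_eq_of_profile_eq hT' hT (hne.1 hpw') hpw₀ hprof]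
        intro Y hY
        have := hsmall Y hY
        omega

theorem branchesAgree_of_half (hT : T.IsTree) (hT' : T'.IsTree) (he1 : 1 ≤ e)
    (he : ∀ x y, T.dist x y ≤ 2 ^ e) (he' : ∀ x y, T'.dist x y ≤ 2 ^ e) {b : ℕ}
    (hA : BranchesAgree T T' e (b / 2)) (hB : PathsAgree T T' e (b / 2))
    (hB' : PathsAgree T' T e (b / 2)) : BranchesAgree T T' e b := by
  intro r p z p' z' hr h X hX
  by_cases h1 : X ∈ T.codesAvoiding p z
  · exact count_codesAvoiding_eq_of_mem hT hT' he1 he hA hB hB' hr h hX h1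
  · by_cases h2 : X ∈ T'.codesAvoiding p' z'
    · exact (count_codesAvoiding_eq_of_mem hT' hT he1 he' hA.symm hB' hB hr h.symm hX h2).symm
    · rw [Multiset.count_eq_zero_of_notMem h1, Multiset.count_eq_zero_of_notMem h2]

/-- Every inner vertex weighs at least 1, so the path is an edge and its single entry is given by
hypothesis. -/
theorem pathsAgree_zero (hT : T.IsTree) (hT' : T'.IsTree) : PathsAgree T T' e 0 := by
  intro r p z p' z' _ h hpz hU hcore
  have hadj : T.Adj p z := by
    by_contra hnadj
    have hq := adj_next hT hpz
    have hqz : T.next p z ≠ z := fun h0 => hnadj (h0 ▸ hq)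
    have := coreSize_profile_split hT hq.ne hqz (between_next hT hpz)
    have hpos : 0 < weight (T.sideCodes (T.next p z) p z) := by unfold weight; omega
    omega
  have hadj' := (adj_iff_of_pairColor_eq h).1 hadj
  rw [profile_of_ne hT hpz, profile_of_ne hT' hadj'.ne, next_of_adj hT hadj,
    next_of_adj hT' hadj', sideCodes_self, sideCodes_self, hU, profile_self, profile_self]

/-- The branch at `y` towards `z` may be too large to compare directly, but the profile from `y` to
`z` determines its code. So that half is settled first; removing this branch gives the side branches
at `y`, and these supply the end condition for the other half. -/
theorem pathsAgree_of_smaller (hT : T.IsTree) (hT' : T'.IsTree) (he1 : 1 ≤ e)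
    (he : ∀ x y, T.dist x y ≤ 2 ^ e) {m : ℕ} (hm : 0 < m)
    (hA : BranchesAgree T T' e (m - 1)) (hB : PathsAgree T T' e (m / 2)) :
    PathsAgree T T' e m := by
  intro r p z p' z' hr h hpz hU hcore
  rcases Nat.eq_zero_or_pos (coreSize (T.profile p z)) with h0 | hpos
  · exact pathsAgree_zero (e := e) hT hT' (by simp [pathRounds]) h hpz hU h0.le
  obtain ⟨y, hpy, hyz, hb, hcore₁, hcore₂, hside⟩ := exists_median hT hpz hpos
  obtain ⟨h1, h2, h3⟩ := lt_pathRounds e hm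
  obtain ⟨r, rfl⟩ : ∃ s, r = s + 1 := ⟨r - 1, by omega⟩
  obtain ⟨y', hpc, hzc⟩ := exists_pairColor_eq h y
  have hyc := pairColor_swap hzc
  have hpy' : p' ≠ y' := fun h0 => hpy ((eq_iff_of_pairColor_eq hpc).2 h0)
  have hyz' : y' ≠ z' := fun h0 => hyz ((eq_iff_of_pairColor_eq hyc).2 h0)
  have hb' : T'.Between p' y' z' := (between_iff_of_pairColor_eq hT he (by omega) hpc hyc
    (pairColor_eq_of_le (Nat.le_succ r) h)).1 hb
  have hUz : T.codesAvoiding z y = T'.codesAvoiding z' y' := by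
    rw [codesAvoiding_congr hT hyz.symm hpz.symm (hb.symm.next_eq hT hyz.symm), hU,
      codesAvoiding_congr hT' hyz'.symm (hb'.symm.ne_right hT' hyz'.symm)
        (hb'.symm.next_eq hT' hyz'.symm)]
  have hprof₂ : T.profile y z = T'.profile y' z' :=
    hB (by omega) hyc hyz hUz (by omega)
  have hcode := code_next_eq_of_profile_eq hT hT' hyz hprof₂
  have hcount := hA (by omega) (pairColor_swap hpc)
  have hcard := card_codesAvoiding_eq hT hT' (by omega) (pairColor_swap hpc)
  have hcons := codesAvoiding_eq_cons hT hb hyz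
  have hcons' := codesAvoiding_eq_cons hT' hb' hyz'
  have hO : T.sideCodes y p z = T'.sideCodes y' p' z' := by
    refine Multiset.eq_of_count_eq_of_card_eq (P := fun X => size X ≤ m - 1)
      (fun X hX => ?_) (fun X hX => ?_) ?_
    · have := hside X hX
      omega
    · have := hcount X hX
      rw [hcons, hcons', hcode, Multiset.count_cons, Multiset.count_cons] at this
      omega
    · rw [hcons, hcons', Multiset.card_cons, Multiset.card_cons] at hcard
      omega
  have hUy : T.codesAvoiding y p = T'.codesAvoiding y' p' := by rw [hcons, hcons', hcode, hO]
  have hprof₁ : T.profile p y = T'.profile p' y' := hB (by omega) hpc hpy hUy (by omega)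
  rw [profile_split hT hpy hb, profile_split hT' hpy' hb', hprof₁, hprof₂, hO]

theorem agree (hT : T.IsTree) (hT' : T'.IsTree) (he1 : 1 ≤ e)
    (he : ∀ x y, T.dist x y ≤ 2 ^ e) (he' : ∀ x y, T'.dist x y ≤ 2 ^ e) (b : ℕ) :
    BranchesAgree T T' e b ∧ PathsAgree T T' e b ∧ PathsAgree T' T e b := by
  induction b using Nat.strong_induction_on with
  | h b ih =>
    rcases Nat.eq_zero_or_pos b with rfl | hb
    · refine ⟨?_, pathsAgree_zero hT hT', pathsAgree_zero hT' hT⟩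
      intro r p z p' z' _ _ X hX
      rw [Multiset.count_eq_zero_of_notMem, Multiset.count_eq_zero_of_notMem]
      · intro h
        have := size_pos_of_mem_codesAvoiding hT' h
        omega
      · intro h
        have := size_pos_of_mem_codesAvoiding hT h
        omega
    · obtain ⟨hA, hB, hB'⟩ := ih (b / 2) (by omega)
      have hA₁ := (ih (b - 1) (by omega)).1
      exact ⟨branchesAgree_of_half hT hT' he1 he he' hA hB hB',
        pathsAgree_of_smaller hT hT' he1 he hb hA₁ hB,
        pathsAgree_of_smaller hT' hT he1 he' hb hA₁.symm hB'⟩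

end Agreement

end SimpleGraph

namespace SimpleGraph

/-! ### From equal codes to an isomorphism. -/

section Isomorphism

variable {V W : Type*} [Fintype V] [Fintype W] {T : SimpleGraph V} {T' : SimpleGraph W}

/-- The vertex `q` together with the branches at `q` through the vertices in `A`. -/
def fan (T : SimpleGraph V) (q : V) (A : Finset V) : Set V :=
  {v | v = q ∨ ∃ r ∈ A, v ∈ T.branch q r}

theorem fan_neighborsAvoiding (hT : T.IsTree) {p q : V} (hpq : T.Adj p q) :
    T.fan q (T.neighborsAvoiding q p) = T.branch p q := by
  ext v
  rw [mem_coe, mem_branch_iff_between hpq]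
  by_cases hqv : q = v
  · obtain rfl := hqv
    simp [fan, Between]
  · rw [between_iff_notMem_branch hT hqv]
    constructor
    · rintro (rfl | ⟨r, hr, hv⟩)
      · exact absurd rfl hqv
      · obtain ⟨h1, h2⟩ := mem_neighborsAvoiding.1 hr
        rwa [← (mem_branch_iff_eq_next hT h1 hqv).1 hv]
    · intro h
      exact Or.inr ⟨T.next q v, mem_neighborsAvoiding.2 ⟨adj_next hT hqv, h⟩,
        mem_branch_next hT hqv⟩

/-- Branches with equal codes are matched, mapped recursively and glued at the root; an edge either
stays in one branch or joins the root to the first vertex of a branch. -/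
theorem exists_injOn_fan (hT : T.IsTree) (hT' : T'.IsTree) (n : ℕ) {q : V} {q' : W}
    {A : Finset V} {A' : Finset W} (hA : ∀ r ∈ A, T.Adj q r) (hA' : ∀ r ∈ A', T'.Adj q' r)
    (hn : ∀ r ∈ A, #(T.branch q r) ≤ n)
    (h : A.val.map (T.code q) = A'.val.map (T'.code q')) :
    ∃ f : V → W, f q = q' ∧ Set.MapsTo f (T.fan q A) (T'.fan q' A') ∧
      Set.InjOn f (T.fan q A) ∧
      ∀ v ∈ T.fan q A, ∀ w ∈ T.fan q A, T.Adj v w → T'.Adj (f v) (f w) := by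
  induction n generalizing q q' A A' with
  | zero =>
    have : A = ∅ := by
      refine eq_empty_of_forall_notMem fun r hr => ?_
      have := hn r hr
      have := card_pos.2 ⟨r, mem_branch_adj (hA r hr)⟩
      omega
    subst this
    have hfan : T.fan q ∅ = {q} := by ext; simp [fan]
    rw [hfan]
    refine ⟨fun _ => q', rfl, fun v _ => Or.inl rfl, by simp, ?_⟩
    rintro v rfl w rfl hvw
    exact absurd hvw T.irrefl
  | succ n ih =>
    have : Nonempty W := ⟨q'⟩
    obtain ⟨σ, hσ, hσ'⟩ := exists_injOn_of_map_eq_map h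
    have key : ∀ r ∈ A, ∃ f : V → W, f r = σ r ∧
        Set.MapsTo f (T.branch q r) (T'.branch q' (σ r)) ∧ Set.InjOn f (T.branch q r) ∧
        ∀ v ∈ T.branch q r, ∀ w ∈ T.branch q r, T.Adj v w → T'.Adj (f v) (f w) := by
      intro r hr
      have hqr := hA r hr
      have hqr' := hA' _ (hσ' r hr).1
      have hcode := congrArg children (hσ' r hr).2
      rw [code_eq hT hqr, code_eq hT' hqr', children_node, children_node] at hcode
      have := ih (q := r) (q' := σ r) (A := T.neighborsAvoiding r q)
        (A' := T'.neighborsAvoiding (σ r) q') (fun s hs => (mem_neighborsAvoiding.1 hs).1)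
        (fun s hs => (mem_neighborsAvoiding.1 hs).1) (fun s hs => by
          have h1 := card_branch_lt hT hqr hs
          have h2 := hn r hr
          omega) hcode.symm
      simpa only [fan_neighborsAvoiding hT hqr, fan_neighborsAvoiding hT' hqr', mem_coe] using this
    choose! f hf1 hf2 hf3 hf4 using key
    let g : V → W := fun v => if v = q then q' else f (T.next q v) v
    have hgq : g q = q' := if_pos rfl
    have hg : ∀ r ∈ A, ∀ v ∈ T.branch q r, g v = f r v := by
      intro r hr v hv
      have hqv := ne_of_mem_branch hv
      rw [(mem_branch_iff_eq_next hT (hA r hr) hqv).1 hv]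
      exact if_neg hqv.symm
    have hgb : ∀ r ∈ A, ∀ v ∈ T.branch q r, g v ∈ T'.branch q' (σ r) := by
      intro r hr v hv
      rw [hg r hr v hv]
      exact hf2 r hr hv
    refine ⟨g, hgq, ?_, ?_, ?_⟩
    · rintro v (rfl | ⟨r, hr, hv⟩)
      · exact Or.inl hgq
      · exact Or.inr ⟨σ r, (hσ' r hr).1, hgb r hr v hv⟩
    · rintro v (rfl | ⟨r, hr, hv⟩) w (rfl | ⟨s, hs, hw⟩) hvw
      · rfl
      · exact absurd (hgq ▸ hvw) (ne_of_mem_branch (hgb s hs w hw))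
      · exact absurd (hgq ▸ hvw).symm (ne_of_mem_branch (hgb r hr v hv))
      · have h1 := hgb r hr v hv
        have h2 := hgb s hs w hw
        rw [← hvw] at h2
        have hne := ne_of_mem_branch h1
        have hrs : r = s := by
          refine hσ hr hs ?_
          rw [(mem_branch_iff_eq_next hT' (hA' _ (hσ' r hr).1) hne).1 h1,
            (mem_branch_iff_eq_next hT' (hA' _ (hσ' s hs).1) hne).1 h2]
        subst hrs
        rw [hg r hr v hv, hg r hr w hw] at hvw
        exact hf3 r hr hv hw hvw
    · have hroot : ∀ r ∈ A, ∀ w ∈ T.branch q r, T.Adj q w → T'.Adj q' (g w) := by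
        intro r hr w hw hqw
        have hrw : r = w := by
          rw [(mem_branch_iff_eq_next hT (hA r hr) hqw.ne).1 hw, next_of_adj hT hqw]
        subst hrw
        rw [hg r hr r hw, hf1 r hr]
        exact hA' _ (hσ' r hr).1
      rintro v (rfl | ⟨r, hr, hv⟩) w (rfl | ⟨s, hs, hw⟩) hvw
      · exact absurd hvw T.irrefl
      · rw [hgq]
        exact hroot s hs w hw hvw
      · rw [hgq]
        exact (hroot r hr v hv hvw.symm).symm
      · have hrs : r = s := by
          have h1 := ne_of_mem_branch hv
          have h2 := ne_of_mem_branch hw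
          rw [(mem_branch_iff_eq_next hT (hA r hr) h1).1 hv,
            (mem_branch_iff_eq_next hT (hA s hs) h2).1 hw, next_eq_next_of_adj hT h1 h2 hvw]
        subst hrs
        rw [hg r hr v hv, hg r hr w hw]
        exact hf4 r hr v hv w hw hvw

/-- If the images of `v` and `w` are adjacent, the image of the path from `v` to `w` is a path
between them, so in a tree it is that edge. -/
theorem nonempty_iso_of_injective_hom (hT : T.IsTree) (hT' : T'.IsTree)
    (hcard : Fintype.card V = Fintype.card W) (f : T →g T') (hf : Function.Injective f) :
    Nonempty (T ≃g T') := by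
  have hbij : Function.Bijective f := (Fintype.bijective_iff_injective_and_card f).2 ⟨hf, hcard⟩
  refine ⟨⟨Equiv.ofBijective f hbij, fun {v w} => ⟨fun h => ?_, fun h => f.map_adj h⟩⟩⟩
  have h : T'.Adj (f v) (f w) := h
  obtain ⟨p, hp, -⟩ := hT.1.exists_path_of_dist v w
  have h1 : (p.map f).IsPath := Walk.IsPath.map hf hp
  have h2 : h.toWalk.IsPath := by simp [h.ne]
  have heq := (hT'.2.subsingleton_path (f v) (f w)).elim ⟨_, h1⟩ ⟨_, h2⟩
  have hlen := congrArg Walk.length (congrArg Subtype.val heq)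
  simp only [Walk.length_map] at hlen
  exact Walk.adj_of_length_eq_one (hlen.trans (by simp))

theorem nonempty_iso_of_codesAvoiding_eq (hT : T.IsTree) (hT' : T'.IsTree)
    (hcard : Fintype.card V = Fintype.card W) {x : V} {x' : W}
    (h : T.codesAvoiding x x = T'.codesAvoiding x' x') : Nonempty (T ≃g T') := by
  obtain ⟨f, -, -, hinj, hadj⟩ := exists_injOn_fan hT hT' (Fintype.card V)
    (fun r hr => (mem_neighborsAvoiding.1 hr).1) (fun r hr => (mem_neighborsAvoiding.1 hr).1)
    (fun r _ => card_le_univ _) h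
  have hfan : ∀ v, v ∈ T.fan x (T.neighborsAvoiding x x) := by
    intro v
    by_cases hxv : v = x
    · exact Or.inl hxv
    · exact Or.inr ⟨T.next x v, mem_neighborsAvoiding.2
        ⟨adj_next hT (Ne.symm hxv), notMem_branch_self⟩, mem_branch_next hT (Ne.symm hxv)⟩
  exact nonempty_iso_of_injective_hom hT hT' hcard
    ⟨f, fun {v w} h => hadj v (hfan v) w (hfan w) h⟩
    fun v w hvw => hinj (hfan v) (hfan w) hvw

theorem nonempty_iso_of_colorMultiset_eq {r k : ℕ} (hT : T.IsTree)
    (hk : Fintype.card V - 1 ≤ 2 ^ k) (hkr : k + 1 ≤ r)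
    (hr : branchRounds (max 1 k) (Fintype.card V / 2) ≤ r)
    (h : T.colorMultiset r = T'.colorMultiset r) : Nonempty (T ≃g T') := by
  have hT' := isTree_of_colorMultiset_eq hT hk hkr h
  have hcard := card_eq_of_colorMultiset_eq h
  have hpow : 2 ^ k ≤ 2 ^ max 1 k := Nat.pow_le_pow_right (by norm_num) (le_max_right 1 k)
  have he : ∀ x y, T.dist x y ≤ 2 ^ max 1 k := fun x y => by
    have := dist_lt_card hT.1 x y
    omega
  have he' : ∀ x y, T'.dist x y ≤ 2 ^ max 1 k := fun x y => by
    have := dist_lt_card hT'.1 x y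
    omega
  obtain ⟨x, hx⟩ := exists_centroid hT
  obtain ⟨x', hx'⟩ := exists_pairColor_eq_of_colorMultiset_eq h x
  have hA := (agree hT hT' (le_max_left 1 k) he he' (Fintype.card V / 2)).1
  refine nonempty_iso_of_codesAvoiding_eq hT hT' hcard
    (hA.codesAvoiding_eq hT hT' (by omega) hr hx' fun X hX => ?_)
  have := hx X hX
  omega

theorem eq_top_of_isTree_of_card_eq_two (hT : T.IsTree) (hcard : Fintype.card V = 2) :
    T = ⊤ := by
  ext x y
  refine ⟨fun h => h.ne, fun h => ?_⟩
  have h1 := dist_lt_card hT.1 x y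
  have h2 := dist_pos hT (top_adj x y |>.1 h)
  exact dist_eq_one_iff_adj.1 (by omega)

theorem nonempty_iso_of_card_eq_two (hT : T.IsTree) (hcard : Fintype.card V = 2)
    (h : T.colorMultiset 1 = T'.colorMultiset 1) : Nonempty (T ≃g T') := by
  have hT' := isTree_of_colorMultiset_eq (k := 0) hT (by simp [hcard]) le_rfl h
  have hcard' := card_eq_of_colorMultiset_eq h
  rw [eq_top_of_isTree_of_card_eq_two hT hcard,
    eq_top_of_isTree_of_card_eq_two hT' (hcard'.symm.trans hcard)]
  exact ⟨Iso.completeGraph (Fintype.equivOfCardEq hcard')⟩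

end Isomorphism

/-! ### Numerical bounds and the conclusion. -/

theorem branchRounds_half_lt {n : ℕ} (hn : 3 ≤ n) :
    branchRounds (max 1 (Nat.clog 2 (n - 1))) (n / 2) + 1 ≤ 3 * Nat.log 2 n ∧
      (n = 2 ^ Nat.log 2 n →
        branchRounds (max 1 (Nat.clog 2 (n - 1))) (n / 2) + 1 < 3 * Nat.log 2 n) := by
  -- For `n > 3` the depth is at most `2 (log n - 1) + (log n + 1) + 1 = 3 log n`; for a power of
  -- two `clog (n - 1)` is at most `log n`, which saves one.
  have hlog := log_two_half (b := n) (by omega)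
  have hlt : n < 2 ^ (Nat.log 2 n + 1) := Nat.lt_pow_succ_log_self (by norm_num) n
  have hclog : Nat.clog 2 (n - 1) ≤ Nat.log 2 n + 1 := Nat.clog_le_of_le_pow (by omega)
  have hclog' : n = 2 ^ Nat.log 2 n → Nat.clog 2 (n - 1) ≤ Nat.log 2 n := fun h =>
    Nat.clog_le_of_le_pow (by omega)
  rw [branchRounds, if_neg (by omega)]
  by_cases h3 : n = 3
  · subst h3
    have h2 : Nat.clog 2 2 = 1 := Nat.clog_eq_one (by norm_num) (by norm_num)
    have h3 : Nat.log 2 3 = 1 := by simp [log_two_half]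
    simp [h2, h3]
  · rw [if_neg (by omega)]
    have h1 : 1 ≤ Nat.log 2 (n / 2) := by
      have := log_two_half (b := n / 2) (by omega)
      omega
    refine ⟨by omega, fun h => ?_⟩
    have := hclog' h
    omega

/-- `Nat.log` is the floor of the real logarithm, so strictness is at stake only for powers of two.
-/
theorem lt_three_mul_logb {n d : ℕ} (hn : 2 ≤ n) (hd : d ≤ 3 * Nat.log 2 n)
    (hd' : n = 2 ^ Nat.log 2 n → d < 3 * Nat.log 2 n) :
    (d : ℝ) < 3 * Real.logb 2 n := by
  have hle : 2 ^ Nat.log 2 n ≤ n := Nat.pow_log_le_self 2 (by omega)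
  have hpow : Real.logb 2 ((2 : ℝ) ^ Nat.log 2 n) = Nat.log 2 n := by
    rw [Real.logb_pow, Real.logb_self_eq_one (by norm_num), mul_one]
  have hpos : (0 : ℝ) < 2 ^ Nat.log 2 n := by positivity
  rcases hle.eq_or_lt with heq | hlt
  · have h1 : (d : ℝ) < 3 * Nat.log 2 n := by exact_mod_cast hd' heq.symm
    have h2 : Real.logb 2 n = Nat.log 2 n := by
      rw [← hpow]
      congr 1
      exact_mod_cast heq.symm
    rwa [h2]
  · have h1 : (d : ℝ) ≤ 3 * Nat.log 2 n := by exact_mod_cast hd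
    have h2 : Real.logb 2 ((2 : ℝ) ^ Nat.log 2 n) < Real.logb 2 n :=
      Real.logb_lt_logb (by norm_num) hpos (by exact_mod_cast hlt)
    rw [hpow] at h2
    linarith

theorem exists_countingDepth_eq_of_colorMultiset {V : Type u} [Fintype V] [Nonempty V]
    {G : SimpleGraph V} {r : ℕ}
    (h : ∀ (W : Type u) [Fintype W] (H : SimpleGraph W),
      G.colorMultiset r = H.colorMultiset r → Nonempty (G ≃g H)) :
    ∃ d : ℕ, countingDepth 3 G = d ∧ d ≤ r + 1 := by
  obtain ⟨φ, hd, hfree, hφ⟩ :=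
    CountingFormula.exists_sentence_colorMultiset.{u} r (G.colorMultiset r)
  have hdef : φ.Defines G := by
    refine ⟨subset_empty.1 hfree, fun s => (hφ V G s).2 rfl, ?_⟩
    intro W _ _ H hiso hH
    have := Fintype.ofFinite W
    exact hiso (h W H ((hφ W H fun _ => Classical.arbitrary W).1 (hH _)).symm)
  have hle : countingDepth 3 G ≤ (φ.depth : ℕ∞) :=
    iInf_le (fun ψ : {ψ : CountingFormula 3 // ψ.Defines G} => (ψ.1.depth : ℕ∞)) ⟨φ, hdef⟩
  obtain ⟨d, hd'⟩ := ENat.ne_top_iff_exists.1 (ne_top_of_le_ne_top (ENat.natCast_ne_top _) hle)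
  refine ⟨d, hd'.symm, ?_⟩
  rw [← hd'] at hle
  exact (by exact_mod_cast hle : d ≤ φ.depth).trans hd

end SimpleGraph

end

theorem mainTheorem5 {V : Type u} [Finite V] (T : SimpleGraph V) (hT : T.IsTree)
    (hn : 2 ≤ Nat.card V) :
    ∃ d : ℕ, countingDepth 3 T = d ∧ (d : ℝ) < 3 * Real.logb 2 (Nat.card V) := by
  have := Fintype.ofFinite V
  have := hT.1.nonempty
  rw [Nat.card_eq_fintype_card] at hn ⊢
  -- For `n = 2` the general count of rounds gives depth 3, one too many; a single round suffices
  -- there.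
  rcases hn.eq_or_lt with h2 | h3
  · have hlog : Nat.log 2 2 = 1 := by simp [SimpleGraph.log_two_half]
    obtain ⟨d, hd, hle⟩ := SimpleGraph.exists_countingDepth_eq_of_colorMultiset (G := T) (r := 1)
      fun W _ H h => SimpleGraph.nonempty_iso_of_card_eq_two hT h2.symm h
    refine ⟨d, hd, SimpleGraph.lt_three_mul_logb hn ?_ fun _ => ?_⟩ <;>
    · rw [← h2, hlog]
      omega
  · obtain ⟨h1, h1'⟩ := SimpleGraph.branchRounds_half_lt h3
    have hlt := (SimpleGraph.lt_branchRounds (max 1 (Nat.clog 2 (Fintype.card V - 1)))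
      (b := Fintype.card V / 2) (by omega)).2.2
    obtain ⟨d, hd, hle⟩ := SimpleGraph.exists_countingDepth_eq_of_colorMultiset (G := T)
      fun W _ H h => SimpleGraph.nonempty_iso_of_colorMultiset_eq hT
        (Nat.le_pow_clog (by norm_num) _) (by omega) le_rfl h
    exact ⟨d, hd, SimpleGraph.lt_three_mul_logb hn (by omega) fun h => by
      have := h1' h
      omega⟩
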